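/- **Theorem 4.1 (with its cases $p=2,3$).** For $n\in\mathbb N_0$ and positive integers $p$ let $$H_n^{(p)}=\sum_{k=1}^n\frac1{k^p},\qquad H_n=H_n^{(1)},\qquad h_n^{(p)}=\sum_{k=1}^n\frac1{(k-1/2)^p},\qquad h_n=h_n^{(1)},$$ and for integers $s\ge2$ let $\zeta(s)=\sum_{n\ge1}n^{-s}$ and $\widetilde t(s)=\sum_{n\ge1}(n-1/2)^{-s}$; put $\widetilde t(1):=0$. For positive integers $p$ and $q>1$ let $$\widehat S_{1^p,q}=\sum_{n=1}^\infty\frac{h_n^{\,p}}{n^q},$$ and for $n\in\mathbb N_0$ let $$C_n(1)=H_n+2\log 2,\qquad C_n(j)=(-1)^{j-1}H_n^{(j)}-\zeta(j)\quad(j\ge2).$$ For a tuple $\kappa=(k_1,\dots,k_{p-1})$ of nonnegative integers write $|\kappa|=k_1+\cdots+k_{p-1}$ and $|\widetilde\kappa|=k_1+2k_2+\cdots+(p-1)k_{p-1}$. Then for all integers $p\ge1$ and $q>1$ all series below converge absolutely, and $$\begin{aligned} (1+(-1)^q)\,\widehat S_{1^p,q}={}&(-1)^{p-1}\sum_{l=0}^{p-1}((-1)^l-1)\binom{p+q-l-2}{q-1}\widetilde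 t(l+1)\,\widetilde t(p+q-l-1)\\ &+\sum_{k=1}^p\binom pk\sum_{\substack{|\kappa|=k\\ |\widetilde\kappa|\le p-1}}\frac{k!}{k_1!\cdots k_{p-1}!}(-1)^{p-1-|\widetilde\kappa|}\sum_{l=0}^{p-1-|\widetilde\kappa|}((-1)^l-1)\binom{p+q-|\widetilde\kappa|-l-2}{q-1}\,\widetilde t(l+1)\sum_{n=1}^\infty\frac{\prod_{j=1}^{p-1}C_{n-1}(j)^{k_j}}{(n-1/2)^{p+q-|\widetilde\kappa|-l-1}}\\ &+(-1)^{p+1}\sum_{\substack{k_1+\cdots+k_p=q\\ k_j\ge1}}\widetilde t(k_1+1)\cdots\widetilde t(k_p+1)\\ &-2(-1)^{p+1}\sum_{\substack{2k_1+k_2+\cdots+k_{p+1}=q\\ k_j\ge1}}\zeta(2k_1)\,\widetilde t(k_2+1)\cdots\widetilde t(k_{p+1}+1). \end{aligned}$$ In particular, for every integer $q>1$, $$(1+(-1)^q)\,\widehat S_{1^2,q}=\pi^2\,\widetilde t(q)-\sum_{\substack{k_1+k_2=q\\ k_j\ge1}}\widetilde t(k_1+1)\widetilde t(k_2+1)+2\sum_{\substack{2k_1+k_2+k_3=q\\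 k_j\ge1}}\zeta(2k_1)\widetilde t(k_2+1)\widetilde t(k_3+1)$$ and $$\begin{aligned}(1+(-1)^q)\,\widehat S_{1^3,q}={}&-2q\,\widetilde t(2)\widetilde t(q+1)+6\,\widetilde t(2)\sum_{n=1}^\infty\frac{H_{n-1}}{(n-1/2)^q}+12\log(2)\,\widetilde t(2)\widetilde t(q)+\sum_{\substack{k_1+k_2+k_3=q\\ k_j\ge1}}\widetilde t(k_1+1)\widetilde t(k_2+1)\widetilde t(k_3+1)\\&-2\sum_{\substack{2k_1+k_2+k_3+k_4=q\\ k_j\ge1}}\zeta(2k_1)\widetilde t(k_2+1)\widetilde t(k_3+1)\widetilde t(k_4+1).\end{aligned}$$ -/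

import Mathlib

noncomputable section

namespace EulerTypeSum

/-- The generalized harmonic number `H_n^{(p)} = ∑_{k=1}^n 1 / k^p`. -/
def genHarmonic (p n : ℕ) : ℝ := ∑ k ∈ Finset.Icc 1 n, 1 / (k : ℝ) ^ p

/-- The odd harmonic number `h_n^{(p)} = ∑_{k=1}^n 1 / (k - 1/2)^p`. -/
def oddHarmonic (p n : ℕ) : ℝ := ∑ k ∈ Finset.Icc 1 n, 1 / ((k : ℝ) - 1 / 2) ^ p

/-- The zeta value `ζ(s) = ∑_{n ≥ 1} 1 / n^s` for integers `s ≥ 2`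
(the index `n : ℕ` stands for `n + 1 ≥ 1`). -/
def zetaValue (s : ℕ) : ℝ := ∑' n : ℕ, 1 / ((n : ℝ) + 1) ^ s

/-- The normalized `t`-value `t̃(s) = ∑_{n ≥ 1} 1 / (n - 1/2)^s` for integers `s ≥ 2`, with the
convention `t̃(1) = 0` (the index `n : ℕ` stands for `n + 1 ≥ 1`). -/
def tTilde (s : ℕ) : ℝ := if s = 1 then 0 else ∑' n : ℕ, 1 / (((n : ℝ) + 1) - 1 / 2) ^ s

/-- The `n`-th term (`n ≥ 1`) of the Euler type sum with upper indices `p_1, …, p_k`. -/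
def typeTTerm {k : ℕ} (P : Fin k → ℕ) (q n : ℕ) : ℝ :=
  (∏ i, oddHarmonic (P i) n) / (n : ℝ) ^ q

/-- The Euler type sum `Ŝ_{p_1 ⋯ p_k, q} = ∑_{n ≥ 1} h_n^{(p_1)} ⋯ h_n^{(p_k)} / n^q`. -/
def typeTSum {k : ℕ} (P : Fin k → ℕ) (q : ℕ) : ℝ := ∑' n : ℕ, typeTTerm P q (n + 1)

/-- `C_n(1) = H_n + 2 log 2` and `C_n(j) = (-1)^(j-1) H_n^{(j)} - ζ(j)` for `j ≥ 2`. -/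
def cCoeff (n j : ℕ) : ℝ :=
  if j = 1 then genHarmonic 1 n + 2 * Real.log 2
  else (-1) ^ (j - 1) * genHarmonic j n - zetaValue j

/-- `|κ| = κ_1 + ⋯ + κ_r`, where `κ j` for `j : Fin r` stands for `κ_{j+1}`. -/
def size {r : ℕ} (κ : Fin r → ℕ) : ℕ := ∑ j, κ j

/-- `|κ̃| = κ_1 + 2 κ_2 + ⋯ + r κ_r`, where `κ j` for `j : Fin r` stands for `κ_{j+1}`. -/
def wsize {r : ℕ} (κ : Fin r → ℕ) : ℕ := ∑ j : Fin r, ((j : ℕ) + 1) * κ j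

/-- The tuples of nonnegative integers `κ_1, …, κ_r` with `|κ| = k` and `|κ̃| ≤ m`. -/
def exponents (r k m : ℕ) : Finset (Fin r → ℕ) :=
  (Fintype.piFinset fun _ : Fin r => Finset.range (k + 1)).filter
    fun κ => size κ = k ∧ wsize κ ≤ m

/-- The multinomial coefficient `k! / (κ_1! ⋯ κ_r!)`. -/
def multinom {r : ℕ} (k : ℕ) (κ : Fin r → ℕ) : ℝ :=
  (Nat.factorial k : ℝ) / ∏ j, (Nat.factorial (κ j) : ℝ)

/-- The `n`-th term (`n ≥ 1`) of the series
`∑_{n ≥ 1} (∏_{j=1}^r C_{n-1}(j)^{κ_j}) / (n - 1/2)^m`. -/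
def cTerm {r : ℕ} (κ : Fin r → ℕ) (m n : ℕ) : ℝ :=
  (∏ j : Fin r, cCoeff (n - 1) ((j : ℕ) + 1) ^ κ j) / ((n : ℝ) - 1 / 2) ^ m

/-- The series `∑_{n ≥ 1} (∏_{j=1}^r C_{n-1}(j)^{κ_j}) / (n - 1/2)^m`. -/
def cSum {r : ℕ} (κ : Fin r → ℕ) (m : ℕ) : ℝ := ∑' n : ℕ, cTerm κ m (n + 1)

/-- The `n`-th term (`n ≥ 1`) of `∑_{n ≥ 1} H_{n-1} / (n - 1/2)^m`. -/
def harmonicTerm (m n : ℕ) : ℝ := genHarmonic 1 (n - 1) / ((n : ℝ) - 1 / 2) ^ m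

/-- The tuples of positive integers `k_1, …, k_r` with `k_1 + ⋯ + k_r = q`. -/
def compositions (r q : ℕ) : Finset (Fin r → ℕ) :=
  (Fintype.piFinset fun _ : Fin r => Finset.Icc 1 q).filter fun k => ∑ j, k j = q

/-- The tuples of positive integers `k_1, …, k_{r+1}` with `2 k_1 + k_2 + ⋯ + k_{r+1} = q`;
`k 0` is `k_1` and `k j.succ`, for `j : Fin r`, runs through `k_2, …, k_{r+1}`. -/
def weightedCompositions (r q : ℕ) : Finset (Fin (r + 1) → ℕ) :=
  (Fintype.piFinset fun _ : Fin (r + 1) => Finset.Icc 1 q).filter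
    fun k => 2 * k 0 + ∑ j : Fin r, k j.succ = q

/-- `zetaValue` is the value of the Riemann zeta function. -/
theorem zetaValue_eq_riemannZeta {s : ℕ} (hs : 1 < s) : (zetaValue s : ℂ) = riemannZeta s := by
  have h := zeta_eq_tsum_one_div_nat_add_one_cpow (s := (s : ℂ)) (by simpa using hs)
  rw [h, zetaValue, Complex.ofReal_tsum]
  simp

theorem mem_exponents {r k m : ℕ} {κ : Fin r → ℕ} :
    κ ∈ exponents r k m ↔ size κ = k ∧ wsize κ ≤ m := by
  simp only [exponents, Finset.mem_filter, Fintype.mem_piFinset, Finset.mem_range,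
    and_iff_right_iff_imp]
  rintro ⟨h, -⟩ j
  have := Finset.single_le_sum (f := κ) (fun i _ => Nat.zero_le _) (Finset.mem_univ j)
  simp only [size] at h
  omega

theorem mem_compositions {r q : ℕ} {k : Fin r → ℕ} :
    k ∈ compositions r q ↔ (∀ j, 1 ≤ k j) ∧ ∑ j, k j = q := by
  simp only [compositions, Finset.mem_filter, Fintype.mem_piFinset, Finset.mem_Icc]
  constructor
  · rintro ⟨h, h'⟩
    exact ⟨fun j => (h j).1, h'⟩
  · rintro ⟨h, h'⟩
    refine ⟨fun j => ⟨h j, ?_⟩, h'⟩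
    have := Finset.single_le_sum (f := k) (fun i _ => Nat.zero_le _) (Finset.mem_univ j)
    omega

theorem mem_weightedCompositions {r q : ℕ} {k : Fin (r + 1) → ℕ} :
    k ∈ weightedCompositions r q ↔
      (∀ j, 1 ≤ k j) ∧ 2 * k 0 + ∑ j : Fin r, k j.succ = q := by
  simp only [weightedCompositions, Finset.mem_filter, Fintype.mem_piFinset, Finset.mem_Icc]
  constructor
  · rintro ⟨h, h'⟩
    exact ⟨fun j => (h j).1, h'⟩
  · rintro ⟨h, h'⟩
    refine ⟨fun j => ⟨h j, ?_⟩, h'⟩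
    have := Finset.single_le_sum (f := k) (fun i _ => Nat.zero_le _) (Finset.mem_univ j)
    rw [Fin.sum_univ_succ] at this
    omega

end EulerTypeSum

end

/-!
The formula is the statement that the residues of `π cot (π z) φ(z) ^ p / z ^ q` add up to `0`,
where `φ(z) = ∑_{n ≥ 1} (1 / (n - 1/2) + 1 / (z - (n - 1/2)))`. At the integers `±n` with `n ≥ 1` the
function `φ` takes the value `h_n`, so these residues give `(1 + (-1)^q) Ŝ_{1^p, q}`; at `0` the
expansions `φ = -∑ t̃(l+1) z^l` and `π cot (π z) = 1/z - 2 ∑ ζ(2k) z^(2k-1)` give the sums over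
compositions; at `n - 1/2` the expansions `φ = 1/s + ∑ C_{n-1}(j) s^(j-1)` and
`π cot (π z) = ∑ ((-1)^l - 1) t̃(l+1) s^l` in `s = z - (n - 1/2)` give the remaining terms, by the
multinomial theorem.

No complex analysis is needed: the series for `π cot (π z)` is truncated to `|k| ≤ M` and that for
`φ` to `n ≤ N`, which leaves a rational function whose residue theorem `resSum_mul_pow_mul` is
algebra. A rational function is represented by the family of its Laurent expansions at all real
points. Functions vanishing at infinity are spanned by the powers of the `1 / (z - a)`, and a
product of two of them has residue sum `0`, as `1/((z-a)(z-b)) = (1/(z-a) - 1/(z-b))/(a-b)` reduces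
it to the cases `1/(z-a)^k`, `k ≥ 2`, and `1/(z-a) - 1/(z-b)`. This gives `residue_identity`.

Letting `M → ∞` for fixed `N` (`residue_identity_cot`) only involves the coefficients of the
truncated cotangent and an absolutely convergent sum over the integers. Then `N → ∞` is a
dominated convergence: subadditivity of the harmonic numbers bounds the truncations of `φ` at `±n`
by `2 h_n` and their expansion coefficients at `n - 1/2` by `2 ζ(2) + 2 H_n`, uniformly in `N`.
-/

noncomputable section

namespace EulerTypeSum

open Filter Topology
open scoped PowerSeries.WithPiTopology

/-! ### Residues of rational functions with real poles -/

/-- Instance search finds the algebra structure of Laurent series that comes from power series,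
whose scalar action is not syntactically the one by coefficients, so this instance and the next one are
supplied for the latter. -/
instance laurentSeries_smulCommClass :
    SMulCommClass ℝ (LaurentSeries ℝ) (LaurentSeries ℝ) where
  smul_comm c f g := by
    simp only [smul_eq_mul, ← HahnSeries.C_mul_eq_smul]
    ring

instance laurentSeries_isScalarTower :
    IsScalarTower ℝ (LaurentSeries ℝ) (LaurentSeries ℝ) where
  smul_assoc c f g := by
    simp only [smul_eq_mul, ← HahnSeries.C_mul_eq_smul]
    ring

/-- The Taylor series of `1 / (c + X)` at `0`, for `c ≠ 0`. -/
def invShift (c : ℝ) : PowerSeries ℝ := PowerSeries.mk fun k => (-1) ^ k / c ^ (k + 1)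

theorem X_add_C_mul_invShift {c : ℝ} (hc : c ≠ 0) :
    (PowerSeries.X + PowerSeries.C c) * invShift c = 1 := by
  ext k
  rw [add_mul, map_add, PowerSeries.coeff_C_mul]
  cases k with
  | zero => simp [invShift, hc]
  | succ k =>
    rw [PowerSeries.coeff_succ_X_mul, invShift, PowerSeries.coeff_mk, PowerSeries.coeff_mk,
      PowerSeries.coeff_one, if_neg (Nat.succ_ne_zero k)]
    field_simp
    ring

/-- The family of Laurent expansions of the rational function `1 / (z - b)`: at the point `a` the
local parameter is `z - a`. -/
def simplePole (b : ℝ) : ℝ → LaurentSeries ℝ := fun a =>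
  if a = b then HahnSeries.single (-1) 1 else (invShift (a - b) : LaurentSeries ℝ)

theorem simplePole_self (a : ℝ) : simplePole a a = HahnSeries.single (-1) 1 := if_pos rfl

theorem simplePole_of_ne {a b : ℝ} (h : a ≠ b) :
    simplePole b a = (invShift (a - b) : LaurentSeries ℝ) := if_neg h

theorem shift_mul_simplePole (a b : ℝ) :
    (HahnSeries.single 1 1 + HahnSeries.C (a - b)) * simplePole b a = 1 := by
  rcases eq_or_ne a b with rfl | h
  · rw [simplePole_self]
    simp
  · rw [simplePole_of_ne h, ← HahnSeries.ofPowerSeries_X, ← HahnSeries.ofPowerSeries_C]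
    rw [← map_add, ← map_mul, X_add_C_mul_invShift (sub_ne_zero.2 h), map_one]

theorem simplePole_mul_simplePole {a b : ℝ} (h : a ≠ b) :
    simplePole a * simplePole b = (a - b)⁻¹ • (simplePole a - simplePole b) := by
  funext c
  have ha := shift_mul_simplePole c a
  have hb := shift_mul_simplePole c b
  simp only [Pi.mul_apply, Pi.smul_apply, Pi.sub_apply]
  have hC : (HahnSeries.C (c - b) - HahnSeries.C (c - a) : LaurentSeries ℝ)
      = HahnSeries.C (a - b) := by
    rw [← map_sub]; congr 1; ring
  have key : simplePole a c - simplePole b c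
      = HahnSeries.C (a - b) * (simplePole a c * simplePole b c) := by
    rw [← hC]
    linear_combination simplePole b c * ha - simplePole a c * hb
  rw [key, HahnSeries.C_mul_eq_smul, smul_smul, inv_mul_cancel₀ (sub_ne_zero.2 h), one_smul]

/-- The sum over the points of `S` of the residues of a family of Laurent expansions. -/
def resSum (S : Finset ℝ) : (ℝ → LaurentSeries ℝ) →ₗ[ℝ] ℝ where
  toFun f := ∑ a ∈ S, (f a).coeff (-1)
  map_add' f g := by simp [Finset.sum_add_distrib]
  map_smul' c f := by simp [Finset.mul_sum]

theorem resSum_apply (S : Finset ℝ) (f : ℝ → LaurentSeries ℝ) :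
    resSum S f = ∑ a ∈ S, (f a).coeff (-1) := rfl

theorem coeff_neg_one_ofPowerSeries (φ : PowerSeries ℝ) :
    (φ : LaurentSeries ℝ).coeff (-1) = 0 := by
  rw [PowerSeries.coeff_coe]
  simp

theorem resSum_simplePole {S : Finset ℝ} {a : ℝ} (ha : a ∈ S) : resSum S (simplePole a) = 1 := by
  rw [resSum_apply, Finset.sum_eq_single a]
  · simp [simplePole_self]
  · intro b _ hb
    rw [simplePole_of_ne hb, coeff_neg_one_ofPowerSeries]
  · exact fun h => absurd ha h

theorem resSum_simplePole_pow (S : Finset ℝ) (a : ℝ) (k : ℕ) :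
    resSum S (simplePole a ^ (k + 2)) = 0 := by
  rw [resSum_apply]
  refine Finset.sum_eq_zero fun b _ => ?_
  rw [Pi.pow_apply]
  rcases eq_or_ne b a with rfl | h
  · rw [simplePole_self, HahnSeries.single_pow, HahnSeries.coeff_single_of_ne]
    simp only [nsmul_eq_mul]
    push_cast
    omega
  · rw [simplePole_of_ne h, ← map_pow, coeff_neg_one_ofPowerSeries]

/-- The rational functions vanishing at infinity whose poles lie in `S`. -/
def polarSpan (S : Finset ℝ) : Submodule ℝ (ℝ → LaurentSeries ℝ) :=
  Submodule.span ℝ {f | ∃ a ∈ S, ∃ k : ℕ, f = simplePole a ^ (k + 1)}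

theorem simplePole_pow_mem {S : Finset ℝ} {a : ℝ} (ha : a ∈ S) (k : ℕ) :
    simplePole a ^ (k + 1) ∈ polarSpan S := Submodule.subset_span ⟨a, ha, k, rfl⟩

theorem simplePole_mem {S : Finset ℝ} {a : ℝ} (ha : a ∈ S) : simplePole a ∈ polarSpan S := by
  simpa using simplePole_pow_mem ha 0

/-- Repeated use of `1/((z-a)(z-b)) = (1/(z-a) - 1/(z-b))/(a-b)` lowers the total order until only
powers of a single factor are left. -/
theorem simplePole_pow_mul_pow {S : Finset ℝ} {a b : ℝ} (ha : a ∈ S) (hb : b ∈ S) (i j : ℕ) :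
    simplePole a ^ (i + 1) * simplePole b ^ (j + 1) ∈ polarSpan S ∧
      resSum S (simplePole a ^ (i + 1) * simplePole b ^ (j + 1)) = 0 := by
  rcases eq_or_ne a b with rfl | h
  · rw [← pow_add, show i + 1 + (j + 1) = i + j + 2 by ring]
    exact ⟨simplePole_pow_mem ha (i + j + 1), resSum_simplePole_pow _ _ _⟩
  · induction hn : i + j generalizing i j with
    | zero =>
      obtain ⟨rfl, rfl⟩ : i = 0 ∧ j = 0 := by omega
      rw [zero_add, pow_one, pow_one, simplePole_mul_simplePole h]
      refine ⟨Submodule.smul_mem _ _ (Submodule.sub_mem _ (simplePole_mem ha)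
        (simplePole_mem hb)), ?_⟩
      rw [map_smul, map_sub, resSum_simplePole ha, resSum_simplePole hb, sub_self, smul_zero]
    | succ n ih =>
      have split : simplePole a ^ (i + 1) * simplePole b ^ (j + 1)
          = (a - b)⁻¹ • (simplePole a ^ (i + 1) * simplePole b ^ j
            - simplePole a ^ i * simplePole b ^ (j + 1)) := by
        rw [pow_succ, pow_succ, mul_mul_mul_comm, simplePole_mul_simplePole h, mul_smul_comm]
        congr 1
        ring
      have h1 : simplePole a ^ (i + 1) * simplePole b ^ j ∈ polarSpan S ∧
          resSum S (simplePole a ^ (i + 1) * simplePole b ^ j) = 0 := by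
        cases j with
        | zero =>
          obtain ⟨i, rfl⟩ : ∃ i', i = i' + 1 := ⟨i - 1, by omega⟩
          rw [pow_zero, mul_one]
          exact ⟨simplePole_pow_mem ha _, resSum_simplePole_pow _ _ _⟩
        | succ j => exact ih i j (by omega)
      have h2 : simplePole a ^ i * simplePole b ^ (j + 1) ∈ polarSpan S ∧
          resSum S (simplePole a ^ i * simplePole b ^ (j + 1)) = 0 := by
        cases i with
        | zero =>
          obtain ⟨j, rfl⟩ : ∃ j', j = j' + 1 := ⟨j - 1, by omega⟩
          rw [pow_zero, one_mul]
          exact ⟨simplePole_pow_mem hb _, resSum_simplePole_pow _ _ _⟩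
        | succ i => exact ih i j (by omega)
      rw [split]
      refine ⟨Submodule.smul_mem _ _ (Submodule.sub_mem _ h1.1 h2.1), ?_⟩
      rw [map_smul, map_sub, h1.2, h2.2, sub_self, smul_zero]

/-- A product of two rational functions vanishing at infinity is again one, and its residues add up
to `0` because it is `O(z⁻²)`. -/
theorem mul_polarSpan {S : Finset ℝ} {f g : ℝ → LaurentSeries ℝ} (hf : f ∈ polarSpan S)
    (hg : g ∈ polarSpan S) : f * g ∈ polarSpan S ∧ resSum S (f * g) = 0 := by
  change f * g ∈ polarSpan S ⊓ LinearMap.ker (resSum S)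
  induction hf using Submodule.span_induction with
  | mem f hf =>
    obtain ⟨a, ha, i, rfl⟩ := hf
    induction hg using Submodule.span_induction with
    | mem g hg =>
      obtain ⟨b, hb, j, rfl⟩ := hg
      exact simplePole_pow_mul_pow ha hb i j
    | zero => rw [mul_zero]; exact Submodule.zero_mem _
    | add g g' _ _ h h' => rw [mul_add]; exact Submodule.add_mem _ h h'
    | smul c g _ h => rw [mul_smul_comm]; exact Submodule.smul_mem _ c h
  | zero => rw [zero_mul]; exact Submodule.zero_mem _
  | add f f' _ _ h h' => rw [add_mul]; exact Submodule.add_mem _ h h'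
  | smul c f _ h => rw [smul_mul_assoc]; exact Submodule.smul_mem _ c h

/-- The residue theorem: `f g (c + u)^p` is `O(z⁻²)` at infinity as `f` and `g` are `O(z⁻¹)`. -/
theorem resSum_mul_pow_mul {S : Finset ℝ} {f g u : ℝ → LaurentSeries ℝ} (hf : f ∈ polarSpan S)
    (hu : u ∈ polarSpan S) (hg : g ∈ polarSpan S) (c : ℝ) (p : ℕ) :
    resSum S (f * (c • 1 + u) ^ p * g) = 0 := by
  refine (mul_polarSpan ?_ hg).2
  induction p with
  | zero => simpa using hf
  | succ p ih =>
    rw [pow_succ, ← mul_assoc, mul_add, mul_smul_comm, mul_one]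
    exact Submodule.add_mem _ (Submodule.smul_mem _ _ ih) (mul_polarSpan ih hu).1

/-! ### The residue theorem for the truncated kernel -/

theorem intCast_ne_half (m : ℤ) (n : ℕ) : (m : ℝ) ≠ (n : ℝ) - 1 / 2 := by
  intro h
  have h' : ((2 * m : ℤ) : ℝ) = ((2 * n - 1 : ℤ) : ℝ) := by push_cast; linarith
  have := Int.cast_injective h'
  omega

/-- The regular part at `0` of `∑_{|k| ≤ M} 1 / (z - k)`. -/
def cotZero (M : ℕ) : PowerSeries ℝ :=
  ∑ k ∈ (Finset.Icc (-(M : ℤ)) M).erase 0, invShift (-(k : ℝ))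

/-- The expansion at `n - 1/2` of `∑_{|k| ≤ M} 1 / (z - k)`. -/
def cotHalf (M n : ℕ) : PowerSeries ℝ :=
  ∑ k ∈ Finset.Icc (-(M : ℤ)) M, invShift ((n : ℝ) - 1 / 2 - k)

/-- The expansion at the integer `m` of `∑_{n=1}^N (1 / (n - 1/2) + 1 / (z - (n - 1/2)))`. -/
def phiInt (N : ℕ) (m : ℤ) : PowerSeries ℝ :=
  ∑ n ∈ Finset.Icc 1 N,
    (PowerSeries.C (1 / ((n : ℝ) - 1 / 2)) + invShift ((m : ℝ) - ((n : ℝ) - 1 / 2)))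

/-- The regular part at `n - 1/2` of `∑_{k=1}^N (1 / (k - 1/2) + 1 / (z - (k - 1/2)))`. -/
def phiHalf (N n : ℕ) : PowerSeries ℝ :=
  PowerSeries.C (oddHarmonic 1 N) + ∑ k ∈ (Finset.Icc 1 N).erase n, invShift ((n : ℝ) - k)

theorem coeff_single_neg_mul (k : ℕ) (φ : PowerSeries ℝ) :
    (HahnSeries.single (-((k : ℤ) + 1)) (1 : ℝ) * (φ : LaurentSeries ℝ)).coeff (-1)
      = PowerSeries.coeff k φ := by
  rw [HahnSeries.coeff_single_mul, one_mul, show (-1 : ℤ) - -((k : ℤ) + 1) = (k : ℤ) by ring,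
    LaurentSeries.coeff_coe_powerSeries]

theorem single_neg_one_pow (k : ℕ) :
    (HahnSeries.single (-1) 1 : LaurentSeries ℝ) ^ k = HahnSeries.single (-(k : ℤ)) 1 := by
  rw [HahnSeries.single_pow]
  simp

theorem single_neg_one_mul_one_add (φ : PowerSeries ℝ) :
    (HahnSeries.single (-1) 1 : LaurentSeries ℝ)
        * ((1 + PowerSeries.X * φ : PowerSeries ℝ) : LaurentSeries ℝ)
      = HahnSeries.single (-1) 1 + (φ : LaurentSeries ℝ) := by
  rw [map_add, map_one (HahnSeries.ofPowerSeries ℤ ℝ), map_mul, HahnSeries.ofPowerSeries_X, mul_add,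
    mul_one, ← mul_assoc]
  simp

/-- At an integer the truncated cotangent is `s⁻¹` times a power series with constant term `1`. -/
theorem simplePole_sum_int {M : ℕ} {m : ℤ} (hm : m ∈ Finset.Icc (-(M : ℤ)) M) :
    (∑ k ∈ Finset.Icc (-(M : ℤ)) M, simplePole (k : ℝ)) (m : ℝ)
      = HahnSeries.single (-1) 1 * ((1 + PowerSeries.X *
        ∑ k ∈ (Finset.Icc (-(M : ℤ)) M).erase m, invShift ((m : ℝ) - k) : PowerSeries ℝ) :
          LaurentSeries ℝ) := by
  rw [single_neg_one_mul_one_add, Finset.sum_apply, ← Finset.add_sum_erase _ _ hm,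
    simplePole_self, map_sum]
  congr 1
  refine Finset.sum_congr rfl fun k hk => simplePole_of_ne ?_
  exact fun h => (Finset.ne_of_mem_erase hk) (Int.cast_injective h).symm

theorem simplePole_sum_half (M n : ℕ) :
    (∑ k ∈ Finset.Icc (-(M : ℤ)) M, simplePole (k : ℝ)) ((n : ℝ) - 1 / 2)
      = (cotHalf M n : LaurentSeries ℝ) := by
  rw [Finset.sum_apply, cotHalf, map_sum]
  exact Finset.sum_congr rfl fun k _ => simplePole_of_ne (intCast_ne_half k n).symm

theorem phi_apply_int (N : ℕ) (m : ℤ) :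
    (oddHarmonic 1 N • (1 : ℝ → LaurentSeries ℝ)
        + ∑ n ∈ Finset.Icc 1 N, simplePole ((n : ℝ) - 1 / 2)) (m : ℝ)
      = (phiInt N m : LaurentSeries ℝ) := by
  rw [Pi.add_apply, Finset.sum_apply, phiInt, Finset.sum_add_distrib, map_add, map_sum, map_sum,
    oddHarmonic, Pi.smul_apply, Pi.one_apply, ← HahnSeries.C_mul_eq_smul, mul_one, map_sum]
  congr 1
  · refine Finset.sum_congr rfl fun n _ => ?_
    rw [HahnSeries.ofPowerSeries_C, pow_one]
  · exact Finset.sum_congr rfl fun n _ => simplePole_of_ne (intCast_ne_half m n)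

theorem phi_apply_half {N n : ℕ} (hn : n ∈ Finset.Icc 1 N) :
    (oddHarmonic 1 N • (1 : ℝ → LaurentSeries ℝ)
        + ∑ n ∈ Finset.Icc 1 N, simplePole ((n : ℝ) - 1 / 2)) ((n : ℝ) - 1 / 2)
      = HahnSeries.single (-1) 1
        * ((1 + PowerSeries.X * phiHalf N n : PowerSeries ℝ) : LaurentSeries ℝ) := by
  rw [single_neg_one_mul_one_add, Pi.add_apply, Finset.sum_apply, ← Finset.add_sum_erase _ _ hn,
    simplePole_self, phiHalf, map_add, HahnSeries.ofPowerSeries_C, map_sum, Pi.smul_apply,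
    Pi.one_apply, ← HahnSeries.C_mul_eq_smul, mul_one, add_left_comm]
  congr 2
  refine Finset.sum_congr rfl fun k hk => ?_
  rw [simplePole_of_ne]
  · congr 2
    ring
  · intro h
    exact Finset.ne_of_mem_erase hk (by exact_mod_cast (sub_left_injective h).symm)

/-- The residue theorem for
`∑_{|k| ≤ M} 1/(z - k) · (∑_{n ≤ N} (1/(n-1/2) + 1/(z-(n-1/2))))^p / z^q`.
The residues are taken at the nonzero integers, at `0`, and at the half-integers. -/
theorem residue_identity (p q M N : ℕ) (hp : 1 ≤ p) (hq : 1 ≤ q) :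
    ∑ m ∈ (Finset.Icc (-(M : ℤ)) M).erase 0,
        (PowerSeries.constantCoeff (phiInt N m)) ^ p / (m : ℝ) ^ q
      + PowerSeries.coeff q ((1 + PowerSeries.X * cotZero M) * phiInt N 0 ^ p)
      + ∑ n ∈ Finset.Icc 1 N, PowerSeries.coeff (p - 1)
          (cotHalf M n * (1 + PowerSeries.X * phiHalf N n) ^ p
            * invShift ((n : ℝ) - 1 / 2) ^ q) = 0 := by
  classical
  have hpow (φ : PowerSeries ℝ) (k : ℕ) : (φ : LaurentSeries ℝ) ^ k = ((φ ^ k : PowerSeries ℝ) :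
    LaurentSeries ℝ) := (map_pow (HahnSeries.ofPowerSeries ℤ ℝ) φ k).symm
  obtain ⟨p, rfl⟩ : ∃ p', p = p' + 1 := ⟨p - 1, by omega⟩
  obtain ⟨q, rfl⟩ : ∃ q', q = q' + 1 := ⟨q - 1, by omega⟩
  set S₁ : Finset ℝ := (Finset.Icc (-(M : ℤ)) M).image (fun m : ℤ => (m : ℝ)) with hS₁
  set S₂ : Finset ℝ := (Finset.Icc 1 N).image (fun n : ℕ => (n : ℝ) - 1 / 2) with hS₂
  have h0 : (0 : ℤ) ∈ Finset.Icc (-(M : ℤ)) M := by simp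
  have hf : ∑ k ∈ Finset.Icc (-(M : ℤ)) M, simplePole (k : ℝ) ∈ polarSpan (S₁ ∪ S₂) :=
    Submodule.sum_mem _ fun k hk => simplePole_mem
      (Finset.mem_union_left _ (Finset.mem_image_of_mem _ hk))
  have hu : ∑ n ∈ Finset.Icc 1 N, simplePole ((n : ℝ) - 1 / 2) ∈ polarSpan (S₁ ∪ S₂) :=
    Submodule.sum_mem _ fun n hn => simplePole_mem
      (Finset.mem_union_right _ (Finset.mem_image_of_mem _ hn))
  have hg : simplePole (0 : ℝ) ^ (q + 1) ∈ polarSpan (S₁ ∪ S₂) :=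
    simplePole_pow_mem (Finset.mem_union_left _
      (Finset.mem_image.2 ⟨0, h0, Int.cast_zero⟩)) q
  have key := resSum_mul_pow_mul hf hu hg (oddHarmonic 1 N) (p + 1)
  have hdisj : Disjoint S₁ S₂ := by
    rw [Finset.disjoint_left]
    intro x h1 h2
    obtain ⟨m, -, rfl⟩ := Finset.mem_image.1 h1
    obtain ⟨n, -, h⟩ := Finset.mem_image.1 h2
    exact intCast_ne_half m n h.symm
  rw [resSum_apply, Finset.sum_union hdisj, Finset.sum_image (fun a _ b _ h => Int.cast_injective h),
    Finset.sum_image (fun a _ b _ h => by exact_mod_cast (sub_left_injective h)),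
    ← Finset.add_sum_erase _ _ h0] at key
  rw [← key, add_comm (∑ m ∈ _, _)]
  congr 1
  congr 1
  · simp only [Pi.mul_apply, Pi.pow_apply]
    rw [simplePole_sum_int h0, phi_apply_int, Int.cast_zero, simplePole_self, single_neg_one_pow,
      hpow, mul_assoc (HahnSeries.single _ _), ← map_mul, mul_right_comm, HahnSeries.single_mul_single,
      one_mul, show (-1 : ℤ) + -((q + 1 : ℕ) : ℤ) = -(((q + 1 : ℕ) : ℤ) + 1) by ring,
      coeff_single_neg_mul]
    simp only [zero_sub]
    rfl
  · refine Finset.sum_congr rfl fun m hm => ?_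
    have hm0 : (m : ℝ) ≠ 0 := by exact_mod_cast Finset.ne_of_mem_erase hm
    simp only [Pi.mul_apply, Pi.pow_apply]
    rw [simplePole_sum_int (Finset.mem_of_mem_erase hm), phi_apply_int, simplePole_of_ne hm0,
      hpow, hpow, mul_assoc, mul_assoc, ← map_mul, ← map_mul]
    have := coeff_single_neg_mul 0 ((1 + PowerSeries.X *
      ∑ k ∈ (Finset.Icc (-(M : ℤ)) M).erase m, invShift ((m : ℝ) - k) : PowerSeries ℝ) *
      (phiInt N m ^ (p + 1) * invShift ((m : ℝ) - 0) ^ (q + 1)))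
    rw [Nat.cast_zero, zero_add] at this
    rw [this, PowerSeries.coeff_zero_eq_constantCoeff_apply]
    simp [invShift, div_eq_mul_inv]
  · refine Finset.sum_congr rfl fun n hn => ?_
    simp only [Pi.mul_apply, Pi.pow_apply]
    have hn0 : (n : ℝ) - 1 / 2 ≠ 0 := by simpa using (intCast_ne_half 0 n).symm
    rw [simplePole_sum_half, phi_apply_half hn, simplePole_of_ne hn0, mul_pow, hpow,
      hpow, single_neg_one_pow, mul_left_comm, ← map_mul,
      mul_assoc (HahnSeries.single _ _), ← map_mul, Nat.cast_succ,
      coeff_single_neg_mul, sub_zero, Nat.add_sub_cancel]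

/-! ### Harmonic numbers and the values of the digamma-like factor at the integers -/

theorem sum_range_add_le {u : ℕ → ℝ} (hu : Antitone u) (a b : ℕ) :
    ∑ k ∈ Finset.range (a + b), u k ≤ ∑ k ∈ Finset.range a, u k + ∑ k ∈ Finset.range b, u k := by
  rw [Finset.sum_range_add]
  gcongr with k
  exact hu (Nat.le_add_left k a)

theorem tendsto_sum_range_add_sub {u : ℕ → ℝ} (hu : Tendsto u atTop (𝓝 0)) (m : ℕ) :
    Tendsto (fun N => ∑ k ∈ Finset.range (N + m), u k - ∑ k ∈ Finset.range N, u k) atTop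
      (𝓝 0) := by
  have h : Tendsto (fun N => ∑ k ∈ Finset.range m, u (N + k)) atTop
      (𝓝 (∑ k ∈ Finset.range m, (0 : ℝ))) :=
    tendsto_finsetSum _ fun k _ => hu.comp (tendsto_add_atTop_nat k)
  simpa [Finset.sum_range_add] using h

theorem sum_Icc_one (f : ℕ → ℝ) (n : ℕ) :
    ∑ k ∈ Finset.Icc 1 n, f k = ∑ k ∈ Finset.range n, f (k + 1) := by
  induction n with
  | zero => simp
  | succ n ih => rw [Finset.sum_Icc_succ_top (by omega), ih, Finset.sum_range_succ]

theorem genHarmonic_eq (p n : ℕ) :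
    genHarmonic p n = ∑ k ∈ Finset.range n, 1 / ((k : ℝ) + 1) ^ p := by
  rw [genHarmonic, sum_Icc_one]
  simp

theorem oddHarmonic_one_eq (n : ℕ) :
    oddHarmonic 1 n = ∑ k ∈ Finset.range n, 1 / ((k : ℝ) + 1 / 2) := by
  rw [oddHarmonic, sum_Icc_one]
  refine Finset.sum_congr rfl fun k _ => ?_
  push_cast
  ring

theorem antitone_one_div_add {c : ℝ} (hc : 0 < c) : Antitone fun k : ℕ => 1 / ((k : ℝ) + c) := by
  intro a b hab
  have : (a : ℝ) ≤ b := by exact_mod_cast hab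
  dsimp only
  gcongr

theorem tendsto_one_div_add (c : ℝ) :
    Tendsto (fun k : ℕ => 1 / ((k : ℝ) + c)) atTop (𝓝 0) := by
  simp_rw [one_div]
  exact tendsto_inv_atTop_zero.comp
    (tendsto_atTop_add_const_right _ c tendsto_natCast_atTop_atTop)

theorem oddHarmonic_zero : oddHarmonic 1 0 = 0 := by simp [oddHarmonic]

theorem oddHarmonic_succ (n : ℕ) :
    oddHarmonic 1 (n + 1) = oddHarmonic 1 n + 1 / ((n : ℝ) + 1 / 2) := by
  rw [oddHarmonic_one_eq, oddHarmonic_one_eq, Finset.sum_range_succ]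

theorem oddHarmonic_nonneg (n : ℕ) : 0 ≤ oddHarmonic 1 n := by
  rw [oddHarmonic_one_eq]
  positivity

theorem genHarmonic_nonneg (p n : ℕ) : 0 ≤ genHarmonic p n := by
  rw [genHarmonic_eq]
  positivity

theorem oddHarmonic_mono : Monotone (oddHarmonic 1) :=
  monotone_nat_of_le_succ fun n => by
    rw [oddHarmonic_succ, le_add_iff_nonneg_right]
    positivity

theorem oddHarmonic_add_le (a b : ℕ) :
    oddHarmonic 1 (a + b) ≤ oddHarmonic 1 a + oddHarmonic 1 b := by
  simp only [oddHarmonic_one_eq]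
  exact sum_range_add_le (antitone_one_div_add (by norm_num)) a b

theorem tendsto_oddHarmonic_add_sub (m : ℕ) :
    Tendsto (fun N => oddHarmonic 1 (N + m) - oddHarmonic 1 N) atTop (𝓝 0) := by
  simp only [oddHarmonic_one_eq]
  exact tendsto_sum_range_add_sub (tendsto_one_div_add _) m

/-- The value at the integer `m` of `∑_{n=1}^N (1 / (n - 1/2) + 1 / (z - (n - 1/2)))`. -/
def phiVal (N : ℕ) (m : ℤ) : ℝ := PowerSeries.constantCoeff (phiInt N m)

theorem phiVal_eq (N : ℕ) (m : ℤ) :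
    phiVal N m = ∑ n ∈ Finset.range N,
      (1 / ((n : ℝ) + 1 / 2) + 1 / ((m : ℝ) - ((n : ℝ) + 1 / 2))) := by
  rw [phiVal, phiInt, map_sum, sum_Icc_one]
  refine Finset.sum_congr rfl fun n _ => ?_
  rw [map_add, PowerSeries.constantCoeff_C, invShift, ← PowerSeries.coeff_zero_eq_constantCoeff_apply,
    PowerSeries.coeff_mk]
  push_cast
  ring

/-- The last index `(N - m) + (m - N)`, with truncated subtractions, is `|N - m|`. -/
theorem phiVal_natCast (N m : ℕ) :
    phiVal N m = oddHarmonic 1 N + oddHarmonic 1 m - oddHarmonic 1 (N - m + (m - N)) := by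
  induction N with
  | zero => simp [phiVal_eq, oddHarmonic_zero]
  | succ N ih =>
    rw [phiVal_eq, Finset.sum_range_succ, ← phiVal_eq, ih, oddHarmonic_succ]
    rcases lt_or_ge N m with h | h
    · obtain ⟨d, rfl⟩ : ∃ d, m = N + 1 + d := ⟨m - (N + 1), by omega⟩
      rw [show N - (N + 1 + d) + (N + 1 + d - N) = d + 1 by omega,
        show N + 1 - (N + 1 + d) + (N + 1 + d - (N + 1)) = d by omega, oddHarmonic_succ]
      push_cast
      rw [show (N : ℝ) + 1 + d - (N + 1 / 2) = d + 1 / 2 by ring]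
      ring
    · obtain ⟨d, rfl⟩ : ∃ d, N = m + d := ⟨N - m, by omega⟩
      rw [show m + d - m + (m - (m + d)) = d by omega,
        show m + d + 1 - m + (m - (m + d + 1)) = d + 1 by omega, oddHarmonic_succ d]
      push_cast
      rw [show (m : ℝ) - (m + d + 1 / 2) = -(d + 1 / 2) by ring, one_div_neg_eq_neg_one_div]
      ring

theorem phiVal_neg_natCast (N m : ℕ) :
    phiVal N (-m) = oddHarmonic 1 N + oddHarmonic 1 m - oddHarmonic 1 (N + m) := by
  induction N with
  | zero => simp [phiVal_eq, oddHarmonic_zero]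
  | succ N ih =>
    rw [phiVal_eq, Finset.sum_range_succ, ← phiVal_eq, ih, oddHarmonic_succ,
      show N + 1 + m = N + m + 1 by omega, oddHarmonic_succ]
    push_cast
    rw [show -(m : ℝ) - (N + 1 / 2) = -(N + m + 1 / 2) by ring, one_div_neg_eq_neg_one_div]
    ring

theorem abs_phiVal_natCast_le (N m : ℕ) : |phiVal N m| ≤ 2 * oddHarmonic 1 m := by
  rw [phiVal_natCast]
  set d := N - m + (m - N) with hd
  have h1 : oddHarmonic 1 N ≤ oddHarmonic 1 d + oddHarmonic 1 m :=
    (oddHarmonic_mono (by omega)).trans (oddHarmonic_add_le d m)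
  have h2 : oddHarmonic 1 d ≤ oddHarmonic 1 N + oddHarmonic 1 m :=
    (oddHarmonic_mono (by omega)).trans (oddHarmonic_add_le N m)
  rw [abs_le]
  constructor <;> linarith [oddHarmonic_nonneg m]

theorem abs_phiVal_neg_natCast_le (N m : ℕ) : |phiVal N (-m)| ≤ 2 * oddHarmonic 1 m := by
  rw [phiVal_neg_natCast]
  have h1 := oddHarmonic_add_le N m
  have h2 : oddHarmonic 1 N ≤ oddHarmonic 1 (N + m) := oddHarmonic_mono (by omega)
  rw [abs_le]
  constructor <;> linarith [oddHarmonic_nonneg m]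

theorem tendsto_phiVal_natCast (m : ℕ) :
    Tendsto (fun N => phiVal N m) atTop (𝓝 (oddHarmonic 1 m)) := by
  rw [← tendsto_add_atTop_iff_nat m]
  simp only [phiVal_natCast]
  have h := (tendsto_oddHarmonic_add_sub m).add_const (oddHarmonic 1 m)
  rw [zero_add] at h
  refine h.congr fun N => ?_
  rw [show N + m - m + (m - (N + m)) = N by omega]
  ring

theorem tendsto_phiVal_neg_natCast (m : ℕ) :
    Tendsto (fun N => phiVal N (-m)) atTop (𝓝 (oddHarmonic 1 m)) := by
  simp only [phiVal_neg_natCast]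
  have h := (tendsto_oddHarmonic_add_sub m).const_sub (oddHarmonic 1 m)
  rw [sub_zero] at h
  exact h.congr fun N => by ring

theorem oddHarmonic_le_two_mul (n : ℕ) : oddHarmonic 1 n ≤ 2 * genHarmonic 1 n := by
  rw [oddHarmonic_one_eq, genHarmonic_eq, Finset.mul_sum]
  refine Finset.sum_le_sum fun k _ => ?_
  rw [pow_one, mul_one_div, div_le_div_iff₀ (by positivity) (by positivity)]
  linarith [(Nat.cast_nonneg k : (0 : ℝ) ≤ k)]

theorem genHarmonic_one_eq_harmonic (n : ℕ) : genHarmonic 1 n = (harmonic n : ℝ) := by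
  rw [genHarmonic_eq, harmonic]
  push_cast
  simp

theorem genHarmonic_one_le (n : ℕ) : genHarmonic 1 n ≤ 1 + Real.log n := by
  rw [genHarmonic_one_eq_harmonic]
  exact harmonic_le_one_add_log n

/-- Powers of harmonic numbers grow more slowly than any power of `n`. -/
theorem summable_genHarmonic_pow (a b : ℝ) (p q : ℕ) (hq : 2 ≤ q) :
    Summable fun n : ℕ => (a + b * genHarmonic 1 (n + 1)) ^ p / ((n : ℝ) + 1) ^ q := by
  -- The `p`-th power of the logarithmic bound is then `O(x^(1/2))`, which leaves `x^(-3/2)`.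
  have hlog : (fun x : ℝ => |a| + |b| * (1 + Real.log x)) =O[atTop]
      fun x => x ^ (1 / (2 * ((p : ℝ) + 1))) := by
    have hx : (fun _ : ℝ => (1 : ℝ)) =O[atTop] fun x => x ^ (1 / (2 * ((p : ℝ) + 1))) := by
      refine Asymptotics.IsBigO.of_bound 1 ?_
      filter_upwards [eventually_ge_atTop 1] with x hx
      rw [one_mul, norm_one, Real.norm_of_nonneg (by positivity)]
      exact Real.one_le_rpow hx (by positivity)
    have hl := (isLittleO_log_rpow_atTop (r := 1 / (2 * ((p : ℝ) + 1))) (by positivity)).isBigO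
    have h1 := hx.const_mul_left |a|
    have h2 := (hx.add hl).const_mul_left |b|
    simpa using h1.add h2
  have hpow := (hlog.pow p).comp_tendsto
    (tendsto_atTop_add_const_right _ (1 : ℝ) tendsto_natCast_atTop_atTop :
      Tendsto (fun n : ℕ => (n : ℝ) + 1) atTop atTop)
  have hmul := hpow.mul (Asymptotics.isBigO_refl (fun n : ℕ => 1 / ((n : ℝ) + 1) ^ q) atTop)
  refine summable_of_isBigO_nat (g := fun n : ℕ => 1 / ((n : ℝ) + 1) ^ (3 / 2 : ℝ)) ?_ ?_
  · have := (Real.summable_one_div_nat_rpow (p := 3 / 2)).2 (by norm_num)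
    simpa using (summable_nat_add_iff 1).2 this
  · refine Asymptotics.IsBigO.trans (g := fun n : ℕ =>
      (|a| + |b| * (1 + Real.log ((n : ℝ) + 1))) ^ p * (1 / ((n : ℝ) + 1) ^ q)) ?_ ?_
    · refine Asymptotics.IsBigO.of_bound 1 (Eventually.of_forall fun n => ?_)
      have hH := genHarmonic_one_le (n + 1)
      have hH0 := genHarmonic_nonneg 1 (n + 1)
      push_cast at hH
      have hl : 0 ≤ Real.log ((n : ℝ) + 1) :=
        Real.log_nonneg (by linarith [(Nat.cast_nonneg n : (0 : ℝ) ≤ n)])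
      rw [one_mul, div_eq_mul_one_div, norm_mul, norm_mul, norm_pow, norm_pow]
      gcongr
      rw [Real.norm_eq_abs, Real.norm_eq_abs,
        abs_of_nonneg (a := |a| + |b| * (1 + Real.log ((n : ℝ) + 1))) (by positivity)]
      refine (abs_add_le _ _).trans ?_
      rw [abs_mul, abs_of_nonneg hH0]
      gcongr
    · refine hmul.trans (Asymptotics.IsBigO.of_bound 1 (Eventually.of_forall fun n => ?_))
      have hn : (1 : ℝ) ≤ (n : ℝ) + 1 := by linarith [(Nat.cast_nonneg n : (0 : ℝ) ≤ n)]
      have hn0 : (0 : ℝ) < (n : ℝ) + 1 := by linarith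
      simp only [Function.comp]
      rw [one_mul, Real.norm_of_nonneg (by positivity), Real.norm_of_nonneg (by positivity),
        mul_one_div, ← Real.rpow_mul_natCast hn0.le, ← Real.rpow_natCast, ← Real.rpow_sub hn0,
        one_div (((n : ℝ) + 1) ^ (3 / 2 : ℝ)), ← Real.rpow_neg hn0.le]
      refine Real.rpow_le_rpow_of_exponent_le hn ?_
      have hq' : (2 : ℝ) ≤ q := by exact_mod_cast hq
      have : 1 / (2 * ((p : ℝ) + 1)) * p ≤ 1 / 2 := by
        rw [one_div_mul_eq_div, div_le_div_iff₀ (by positivity) (by positivity)]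
        linarith
      linarith

theorem summable_oddHarmonic_pow (p q : ℕ) (hq : 2 ≤ q) :
    Summable fun n : ℕ => (2 * oddHarmonic 1 (n + 1)) ^ p / ((n : ℝ) + 1) ^ q := by
  refine Summable.of_nonneg_of_le (fun n => ?_) (fun n => ?_) (summable_genHarmonic_pow 0 4 p q hq)
  · have := oddHarmonic_nonneg (n + 1)
    positivity
  · have := oddHarmonic_nonneg (n + 1)
    have := oddHarmonic_le_two_mul (n + 1)
    gcongr
    linarith

/-! ### The partial sums of the cotangent -/

theorem sum_Icc_neg_erase_zero (f : ℤ → ℝ) (M : ℕ) :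
    ∑ k ∈ (Finset.Icc (-(M : ℤ)) M).erase 0, f k
      = ∑ n ∈ Finset.range M, (f (n + 1) + f (-(n + 1))) := by
  have h0 (M : ℕ) : (0 : ℤ) ∈ Finset.Icc (-(M : ℤ)) M := by simp
  induction M with
  | zero => simp
  | succ M ih =>
    rw [Finset.sum_range_succ, ← ih, Finset.sum_erase_eq_sub (h0 _), Finset.sum_erase_eq_sub (h0 _),
      Nat.cast_succ, Finset.Icc_succ_succ, Finset.sum_union (by simp), Finset.sum_pair (by omega)]
    ring

theorem sum_Icc_neg_eq (f : ℤ → ℝ) (M : ℕ) :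
    ∑ k ∈ Finset.Icc (-(M : ℤ)) M, f k
      = ∑ n ∈ Finset.range M, (f n + f (-(n + 1))) + f M := by
  induction M with
  | zero => simp
  | succ M ih =>
    rw [Finset.sum_range_succ, Nat.cast_succ, Finset.Icc_succ_succ, Finset.sum_union (by simp),
      Finset.sum_pair (by omega), ih]
    ring

theorem sum_Icc_neg_shift (f : ℤ → ℝ) (M : ℕ) :
    ∑ k ∈ Finset.Icc (-(M : ℤ)) M, f (k - 1)
      = ∑ k ∈ Finset.Icc (-(M : ℤ)) M, f k + f (-(M : ℤ) - 1) - f M := by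
  induction M with
  | zero => simp
  | succ M ih =>
    rw [Nat.cast_succ, Finset.Icc_succ_succ, Finset.sum_union (by simp),
      Finset.sum_pair (by omega), Finset.sum_union (by simp), Finset.sum_pair (by omega), ih]
    ring_nf

theorem summable_zeta_terms {s : ℕ} (hs : 2 ≤ s) :
    Summable fun n : ℕ => 1 / ((n : ℝ) + 1) ^ s := by
  have := (summable_nat_add_iff 1).2 (Real.summable_one_div_nat_pow (p := s).2 (by omega))
  simpa using this

theorem hasSum_zetaValue {s : ℕ} (hs : 2 ≤ s) :
    HasSum (fun n : ℕ => 1 / ((n : ℝ) + 1) ^ s) (zetaValue s) :=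
  (summable_zeta_terms hs).hasSum

theorem hasSum_tTilde {s : ℕ} (hs : 2 ≤ s) :
    HasSum (fun n : ℕ => 1 / (((n : ℝ) + 1) - 1 / 2) ^ s) (tTilde s) := by
  rw [tTilde, if_neg (by omega)]
  refine Summable.hasSum (Summable.of_nonneg_of_le (fun n => ?_) (fun n => ?_)
    ((summable_zeta_terms hs).mul_left (2 ^ s)))
  · have : (0 : ℝ) < (n : ℝ) + 1 - 1 / 2 := by
      linarith [(Nat.cast_nonneg n : (0 : ℝ) ≤ n)]
    positivity
  · have : (0 : ℝ) < (n : ℝ) + 1 - 1 / 2 := by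
      linarith [(Nat.cast_nonneg n : (0 : ℝ) ≤ n)]
    rw [mul_one_div, div_le_div_iff₀ (by positivity) (by positivity), one_mul, ← mul_pow]
    gcongr
    linarith [(Nat.cast_nonneg n : (0 : ℝ) ≤ n)]

/-- The regular part of `π cot (π z)` at an integer. -/
def cotZeroLim : PowerSeries ℝ :=
  PowerSeries.mk fun l => if Odd l then -2 * zetaValue (l + 1) else 0

/-- The expansion of `π cot (π z)` at a half-integer. -/
def cotHalfLim : PowerSeries ℝ :=
  PowerSeries.mk fun l => ((-1) ^ l - 1) * tTilde (l + 1)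

theorem tendsto_cotZero : Tendsto cotZero atTop (𝓝 cotZeroLim) := by
  rw [PowerSeries.WithPiTopology.tendsto_iff_coeff_tendsto]
  intro l
  have hc (M : ℕ) : PowerSeries.coeff l (cotZero M)
      = (-(1 + (-1) ^ (l + 1))) * ∑ n ∈ Finset.range M, 1 / ((n : ℝ) + 1) ^ (l + 1) := by
    rw [cotZero, map_sum, sum_Icc_neg_erase_zero (fun k => PowerSeries.coeff l (invShift (-(k : ℝ)))),
      Finset.mul_sum]
    refine Finset.sum_congr rfl fun n _ => ?_
    simp only [invShift, PowerSeries.coeff_mk]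
    push_cast
    have hn : ((n : ℝ) + 1) ^ (l + 1) ≠ 0 := by positivity
    rcases neg_one_pow_eq_or ℝ l with h | h <;>
    · rw [neg_neg, neg_pow ((n : ℝ) + 1), pow_succ (-1 : ℝ) l, h]
      field_simp
      try norm_num
  simp only [hc, cotZeroLim, PowerSeries.coeff_mk]
  rcases Nat.even_or_odd l with h | h
  · simp [pow_succ, h.neg_one_pow, h]
  · rw [if_pos h, pow_succ, h.neg_one_pow]
    have hl : 2 ≤ l + 1 := by
      have := h.pos
      omega
    have := (hasSum_zetaValue hl).tendsto_sum_nat.const_mul (-2)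
    convert this using 3
    norm_num

theorem tendsto_coeff_invShift {u : ℕ → ℝ} (hu : Tendsto (fun M => |u M|) atTop atTop) (l : ℕ) :
    Tendsto (fun M => PowerSeries.coeff l (invShift (u M))) atTop (𝓝 0) := by
  rw [tendsto_zero_iff_abs_tendsto_zero]
  have h : Tendsto (fun M => (|u M| ^ (l + 1))⁻¹) atTop (𝓝 0) :=
    tendsto_inv_atTop_zero.comp ((tendsto_pow_atTop (Nat.succ_ne_zero l)).comp hu)
  refine h.congr fun M => ?_
  simp [invShift, Function.comp, abs_div]

/-- The limit is the same at all half-integers as a shift only changes two boundary terms; at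
`-1/2` the terms pair up. -/
theorem tendsto_cotHalf (n : ℕ) : Tendsto (fun M => cotHalf M n) atTop (𝓝 cotHalfLim) := by
  rw [PowerSeries.WithPiTopology.tendsto_iff_coeff_tendsto]
  intro l
  simp only [cotHalf, map_sum]
  induction n with
  | zero =>
    have hb := tendsto_coeff_invShift (u := fun M => ((0 : ℕ) : ℝ) - 1 / 2 - ((M : ℤ) : ℝ)) (by
      refine tendsto_atTop_mono (fun M => ?_) tendsto_natCast_atTop_atTop
      push_cast
      exact le_trans (by linarith) (neg_le_abs _)) l
    have hc (M : ℕ) : ∑ k ∈ Finset.Icc (-(M : ℤ)) M,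
          PowerSeries.coeff l (invShift (((0 : ℕ) : ℝ) - 1 / 2 - (k : ℝ)))
        = ((-1) ^ l - 1) * ∑ n ∈ Finset.range M, 1 / (((n : ℝ) + 1) - 1 / 2) ^ (l + 1)
          + PowerSeries.coeff l (invShift (((0 : ℕ) : ℝ) - 1 / 2 - ((M : ℤ) : ℝ))) := by
      rw [sum_Icc_neg_eq
        (fun k => PowerSeries.coeff l (invShift (((0 : ℕ) : ℝ) - 1 / 2 - (k : ℝ)))), Finset.mul_sum]
      congr 1
      refine Finset.sum_congr rfl fun n _ => ?_
      simp only [invShift, PowerSeries.coeff_mk]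
      push_cast
      have hn : ((n : ℝ) + 1 - 1 / 2) ^ (l + 1) ≠ 0 := by
        have : (0 : ℝ) < (n : ℝ) + 1 - 1 / 2 := by
          linarith [(Nat.cast_nonneg n : (0 : ℝ) ≤ n)]
        positivity
      rw [show (0 : ℝ) - 1 / 2 - n = -((n : ℝ) + 1 - 1 / 2) by ring,
        show (0 : ℝ) - 1 / 2 - -((n : ℝ) + 1) = (n : ℝ) + 1 - 1 / 2 by ring,
        neg_pow ((n : ℝ) + 1 - 1 / 2)]
      generalize ((n : ℝ) + 1 - 1 / 2) ^ (l + 1) = x at hn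
      rcases neg_one_pow_eq_or ℝ l with h | h <;>
      · rw [pow_succ (-1 : ℝ) l, h]
        field_simp
        try norm_num
    simp only [hc, cotHalfLim, PowerSeries.coeff_mk]
    rcases Nat.eq_zero_or_pos l with rfl | hl
    · simpa using hb
    · simpa using ((hasSum_tTilde (by omega : 2 ≤ l + 1)).tendsto_sum_nat.const_mul
        ((-1) ^ l - 1)).add hb
  | succ n ih =>
    have hb₁ := tendsto_coeff_invShift
      (u := fun M => (n : ℝ) - 1 / 2 - ((-(M : ℤ) - 1 : ℤ) : ℝ)) (by
      refine tendsto_atTop_mono (fun M => ?_) tendsto_natCast_atTop_atTop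
      push_cast
      exact le_trans (by linarith [(Nat.cast_nonneg n : (0 : ℝ) ≤ n)]) (le_abs_self _)) l
    have hb₂ := tendsto_coeff_invShift (u := fun M => (n : ℝ) - 1 / 2 - ((M : ℤ) : ℝ)) (by
      refine tendsto_atTop_mono (fun M => ?_)
        (tendsto_atTop_add_const_right _ (-(n : ℝ)) tendsto_natCast_atTop_atTop)
      push_cast
      exact le_trans (by linarith) (neg_le_abs _)) l
    have h := (ih.add hb₁).sub hb₂
    rw [add_zero, sub_zero] at h
    refine h.congr fun M => ?_
    rw [← sum_Icc_neg_shift (fun k => PowerSeries.coeff l (invShift ((n : ℝ) - 1 / 2 - (k : ℝ))))]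
    refine Finset.sum_congr rfl fun k _ => ?_
    push_cast
    ring_nf

/-- The residues at `±(n + 1)` are bounded uniformly in the truncation `N`. -/
theorem abs_phiVal_pair_le (p q N n : ℕ) :
    |phiVal N ((n : ℤ) + 1) ^ p / ((((n : ℤ) + 1 : ℤ)) : ℝ) ^ q
        + phiVal N (-((n : ℤ) + 1)) ^ p / (((-((n : ℤ) + 1) : ℤ)) : ℝ) ^ q|
      ≤ 2 * ((2 * oddHarmonic 1 (n + 1)) ^ p / ((n : ℝ) + 1) ^ q) := by
  refine (abs_add_le _ _).trans ?_
  have h1 := abs_phiVal_natCast_le N (n + 1)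
  have h2 := abs_phiVal_neg_natCast_le N (n + 1)
  rw [Nat.cast_succ] at h1 h2
  rw [Int.cast_neg, Int.cast_add, Int.cast_one, Int.cast_natCast, abs_div, abs_div, abs_pow, abs_pow,
    abs_pow, abs_pow, abs_neg, abs_of_nonneg (by positivity : (0 : ℝ) ≤ (n : ℝ) + 1), two_mul]
  gcongr

/-- The limit `M → ∞` of `residue_identity`: the truncated cotangent becomes `π cot (π z)`. -/
theorem residue_identity_cot (p q N : ℕ) (hp : 1 ≤ p) (hq : 2 ≤ q) :
    ∑' n : ℕ, (phiVal N ((n : ℤ) + 1) ^ p / ((((n : ℤ) + 1 : ℤ)) : ℝ) ^ q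
        + phiVal N (-((n : ℤ) + 1)) ^ p / (((-((n : ℤ) + 1) : ℤ)) : ℝ) ^ q)
      + PowerSeries.coeff q ((1 + PowerSeries.X * cotZeroLim) * phiInt N 0 ^ p)
      + ∑ n ∈ Finset.Icc 1 N, PowerSeries.coeff (p - 1)
          (cotHalfLim * (1 + PowerSeries.X * phiHalf N n) ^ p
            * invShift ((n : ℝ) - 1 / 2) ^ q) = 0 := by
  have hsum : Summable fun n : ℕ => phiVal N ((n : ℤ) + 1) ^ p / ((((n : ℤ) + 1 : ℤ)) : ℝ) ^ q
      + phiVal N (-((n : ℤ) + 1)) ^ p / (((-((n : ℤ) + 1) : ℤ)) : ℝ) ^ q :=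
    Summable.of_norm_bounded ((summable_oddHarmonic_pow p q hq).mul_left 2)
      fun n => abs_phiVal_pair_le p q N n
  have h1 := hsum.hasSum.tendsto_sum_nat
  have h2 : Tendsto (fun M => PowerSeries.coeff q
      ((1 + PowerSeries.X * cotZero M) * phiInt N 0 ^ p)) atTop
      (𝓝 (PowerSeries.coeff q ((1 + PowerSeries.X * cotZeroLim) * phiInt N 0 ^ p))) :=
    ((PowerSeries.WithPiTopology.continuous_coeff ℝ q).tendsto _).comp
      (((tendsto_cotZero.const_mul _).const_add _).mul_const _)
  have h3 : Tendsto (fun M => ∑ n ∈ Finset.Icc 1 N, PowerSeries.coeff (p - 1)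
      (cotHalf M n * (1 + PowerSeries.X * phiHalf N n) ^ p * invShift ((n : ℝ) - 1 / 2) ^ q)) atTop
      (𝓝 (∑ n ∈ Finset.Icc 1 N, PowerSeries.coeff (p - 1)
        (cotHalfLim * (1 + PowerSeries.X * phiHalf N n) ^ p
          * invShift ((n : ℝ) - 1 / 2) ^ q))) :=
    tendsto_finsetSum _ fun n _ =>
      ((PowerSeries.WithPiTopology.continuous_coeff ℝ (p - 1)).tendsto _).comp
        (((tendsto_cotHalf n).mul_const _).mul_const _)
  refine tendsto_nhds_unique ((h1.add h2).add h3) (tendsto_const_nhds.congr fun M => ?_)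
  rw [← residue_identity p q M N hp (by omega),
    sum_Icc_neg_erase_zero (fun m => PowerSeries.constantCoeff (phiInt N m) ^ p / (m : ℝ) ^ q)]
  rfl

/-- Dominated convergence for the residues at the nonzero integers, the function `φ` taking the same
value `h_n` at `n` and `-n`. -/
theorem tendsto_integer_residues (p q : ℕ) (hq : 2 ≤ q) :
    Tendsto (fun N => ∑' n : ℕ, (phiVal N ((n : ℤ) + 1) ^ p / ((((n : ℤ) + 1 : ℤ)) : ℝ) ^ q
        + phiVal N (-((n : ℤ) + 1)) ^ p / (((-((n : ℤ) + 1) : ℤ)) : ℝ) ^ q)) atTop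
      (𝓝 ((1 + (-1) ^ q) * typeTSum (fun _ : Fin p => 1) q)) := by
  rw [typeTSum, ← tsum_mul_left]
  refine tendsto_tsum_of_dominated_convergence ((summable_oddHarmonic_pow p q hq).mul_left 2)
    (fun n => ?_) (Eventually.of_forall fun N n => abs_phiVal_pair_le p q N n)
  have h1 := tendsto_phiVal_natCast (n + 1)
  have h2 := tendsto_phiVal_neg_natCast (n + 1)
  rw [Nat.cast_succ] at h1 h2
  have h := ((h1.pow p).div_const ((((n : ℤ) + 1 : ℤ) : ℝ) ^ q)).add
    ((h2.pow p).div_const (((-((n : ℤ) + 1) : ℤ) : ℝ) ^ q))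
  convert h using 2
  rw [typeTTerm, Finset.prod_const, Finset.card_univ, Fintype.card_fin]
  push_cast
  rw [neg_pow ((n : ℝ) + 1)]
  rcases neg_one_pow_eq_or ℝ q with h | h <;>
  · rw [h]
    field_simp
    try norm_num

theorem summable_typeTTerm (p q : ℕ) (hq : 2 ≤ q) :
    Summable fun n : ℕ => typeTTerm (fun _ : Fin p => 1) q (n + 1) := by
  refine ((summable_oddHarmonic_pow p q hq).mul_left ((1 / 2) ^ p)).congr fun n => ?_
  rw [typeTTerm, Finset.prod_const, Finset.card_univ, Fintype.card_fin, ← mul_div_assoc, ← mul_pow]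
  push_cast
  ring_nf

/-! ### The residues at the half-integers -/

theorem multinom_eq {r k : ℕ} {κ : Fin r → ℕ} (hκ : size κ = k) :
    multinom k κ = (Nat.multinomial Finset.univ κ : ℝ) := by
  have h := Nat.multinomial_spec Finset.univ κ
  rw [show ∑ i, κ i = k from hκ] at h
  rw [multinom, ← h]
  push_cast
  rw [mul_div_cancel_left₀]
  exact Finset.prod_ne_zero_iff.2 fun i _ => by positivity

/-- The multinomial theorem for power series, modulo `X ^ (r + 1)`. -/
theorem X_pow_dvd_pow_sub_multinomial (φ : PowerSeries ℝ) (r k : ℕ) :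
    (PowerSeries.X : PowerSeries ℝ) ^ (r + 1) ∣ (PowerSeries.X * φ) ^ k -
      ∑ κ ∈ Finset.piAntidiag (Finset.univ : Finset (Fin r)) k, PowerSeries.X ^ wsize κ *
        PowerSeries.C (multinom k κ * ∏ j : Fin r, PowerSeries.coeff (j : ℕ) φ ^ κ j) := by
  have h1 : (PowerSeries.X : PowerSeries ℝ) ^ (r + 1) ∣ PowerSeries.X * φ -
      ∑ j : Fin r, PowerSeries.C (PowerSeries.coeff (j : ℕ) φ) * PowerSeries.X ^ ((j : ℕ) + 1) := by
    rw [PowerSeries.X_pow_dvd_iff]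
    intro m hm
    rw [map_sub, map_sum]
    cases m with
    | zero => simp [PowerSeries.coeff_C_mul, PowerSeries.coeff_X_pow]
    | succ m =>
      rw [PowerSeries.coeff_succ_X_mul, Finset.sum_eq_single (⟨m, by omega⟩ : Fin r)]
      · simp [PowerSeries.coeff_C_mul, PowerSeries.coeff_X_pow]
      · intro j _ hj
        have : m ≠ (j : ℕ) := fun h => hj (Fin.ext h.symm)
        simp [PowerSeries.coeff_C_mul, PowerSeries.coeff_X_pow, this]
      · exact fun h => absurd (Finset.mem_univ _) h
  have h2 := h1.trans (sub_dvd_pow_sub_pow (PowerSeries.X * φ) (∑ j : Fin r,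
    PowerSeries.C (PowerSeries.coeff (j : ℕ) φ) * PowerSeries.X ^ ((j : ℕ) + 1)) k)
  convert h2 using 2
  rw [Finset.sum_pow_eq_sum_piAntidiag]
  refine Finset.sum_congr rfl fun κ hκ => ?_
  rw [multinom_eq (Finset.mem_piAntidiag.1 hκ).1, map_mul, map_prod, wsize,
    ← Finset.prod_pow_eq_pow_sum]
  simp only [mul_pow, Finset.prod_mul_distrib, map_pow, map_natCast, pow_mul]
  ring

/-- With `r = p - 1` this computes a residue at a pole of order `p`; only the coefficients of `φ` of
index less than `r` enter. -/
theorem coeff_mul_pow_mul (A φ E : PowerSeries ℝ) (r p : ℕ) :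
    PowerSeries.coeff r (A * (1 + PowerSeries.X * φ) ^ p * E)
      = ∑ k ∈ Finset.range (p + 1), (Nat.choose p k : ℝ) *
          ∑ κ ∈ exponents r k r,
            multinom k κ * (∏ j : Fin r, PowerSeries.coeff (j : ℕ) φ ^ κ j) *
              ∑ l ∈ Finset.range (r - wsize κ + 1),
                PowerSeries.coeff l A * PowerSeries.coeff (r - wsize κ - l) E := by
  rw [mul_right_comm, add_comm, add_pow, Finset.mul_sum, map_sum]
  refine Finset.sum_congr rfl fun k _ => ?_
  rw [one_pow, mul_one, mul_comm _ ((p.choose k : ℕ) : PowerSeries ℝ), mul_left_comm,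
    ← nsmul_eq_mul, map_nsmul, nsmul_eq_mul]
  congr 1
  have hdvd := (X_pow_dvd_pow_sub_multinomial φ r k).mul_left (A * E)
  rw [mul_sub] at hdvd
  have h := PowerSeries.X_pow_dvd_iff.1 hdvd r (Nat.lt_succ_self r)
  rw [map_sub, sub_eq_zero] at h
  rw [h, Finset.mul_sum, map_sum]
  have hsub : exponents r k r ⊆ Finset.piAntidiag (Finset.univ : Finset (Fin r)) k := by
    intro κ hκ
    rw [Finset.mem_piAntidiag]
    exact ⟨(mem_exponents.1 hκ).1, fun _ _ => Finset.mem_univ _⟩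
  symm
  refine Finset.sum_subset_zero_on_sdiff hsub (fun κ hκ => ?_) (fun κ hκ => ?_)
  · rw [Finset.mem_sdiff, Finset.mem_piAntidiag, mem_exponents] at hκ
    have hw : ¬ wsize κ ≤ r := fun hw => hκ.2 ⟨hκ.1.1, hw⟩
    rw [mul_left_comm, PowerSeries.coeff_X_pow_mul', if_neg hw]
  · rw [mul_left_comm, PowerSeries.coeff_X_pow_mul', if_pos (mem_exponents.1 hκ).2,
      PowerSeries.coeff_mul_C, PowerSeries.coeff_mul,
      Finset.Nat.sum_antidiagonal_eq_sum_range_succ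
        (fun i j => PowerSeries.coeff i A * PowerSeries.coeff j E), mul_comm]

theorem coeff_invShift_pow (x : ℝ) {q : ℕ} (hq : 1 ≤ q) (m : ℕ) :
    PowerSeries.coeff m (invShift x ^ q)
      = (-1) ^ m * (Nat.choose (q - 1 + m) (q - 1) : ℝ) / x ^ (q + m) := by
  obtain ⟨q, rfl⟩ : ∃ q', q = q' + 1 := ⟨q - 1, by omega⟩
  have h : invShift x = PowerSeries.C (x⁻¹) * PowerSeries.rescale (-x⁻¹) (PowerSeries.mk 1) := by
    ext k
    rw [PowerSeries.coeff_C_mul, PowerSeries.coeff_rescale, invShift, PowerSeries.coeff_mk,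
      PowerSeries.coeff_mk, Pi.one_apply, mul_one, neg_pow x⁻¹, pow_succ, inv_pow]
    ring
  rw [h, mul_pow, ← map_pow, ← map_pow, PowerSeries.mk_one_pow_eq_mk_choose_add,
    PowerSeries.coeff_C_mul, PowerSeries.coeff_rescale, PowerSeries.coeff_mk, neg_pow x⁻¹,
    Nat.add_sub_cancel, pow_add, inv_pow, inv_pow]
  ring

/-- The half-integer is `n - 1/2` with `n = a + 1`, and the truncation is at `N = n + d`. -/
theorem coeff_phiHalf (a d j : ℕ) :
    PowerSeries.coeff j (phiHalf (a + 1 + d) (a + 1))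
      = (if j = 0 then oddHarmonic 1 (a + 1 + d) else 0)
        + (-1) ^ j * genHarmonic (j + 1) a - genHarmonic (j + 1) d := by
  rw [phiHalf, map_add, PowerSeries.coeff_C, map_sum,
    Finset.sum_erase_eq_sub (by simp : a + 1 ∈ Finset.Icc 1 (a + 1 + d)), sum_Icc_one,
    Finset.sum_range_add, Finset.sum_range_succ]
  have h1 : ∑ k ∈ Finset.range a, PowerSeries.coeff j (invShift (((a + 1 : ℕ) : ℝ) - (k + 1 : ℕ)))
      = (-1) ^ j * genHarmonic (j + 1) a := by
    rw [genHarmonic_eq, ← Finset.sum_range_reflect, Finset.mul_sum]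
    refine Finset.sum_congr rfl fun k hk => ?_
    have hk := Finset.mem_range.1 hk
    obtain ⟨b, rfl⟩ : ∃ b, a = k + 1 + b := ⟨a - (k + 1), by omega⟩
    rw [invShift, PowerSeries.coeff_mk, show k + 1 + b - 1 - k = b by omega, mul_one_div]
    push_cast
    ring_nf
  have h2 : ∑ k ∈ Finset.range d,
      PowerSeries.coeff j (invShift (((a + 1 : ℕ) : ℝ) - (a + 1 + k + 1 : ℕ)))
      = -genHarmonic (j + 1) d := by
    rw [genHarmonic_eq, ← Finset.sum_neg_distrib]
    refine Finset.sum_congr rfl fun k _ => ?_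
    have hk : ((k : ℝ) + 1) ^ (j + 1) ≠ 0 := by positivity
    rw [invShift, PowerSeries.coeff_mk]
    push_cast
    rw [show (a : ℝ) + 1 - (a + 1 + k + 1) = -((k : ℝ) + 1) by ring, neg_pow ((k : ℝ) + 1)]
    generalize ((k : ℝ) + 1) ^ (j + 1) = x at hk
    rcases neg_one_pow_eq_or ℝ j with h | h <;>
    · rw [pow_succ (-1 : ℝ) j, h]
      field_simp
      try norm_num
  rw [h1, h2]
  ring

theorem genHarmonic_le_zetaValue_two {s : ℕ} (hs : 2 ≤ s) (n : ℕ) :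
    genHarmonic s n ≤ zetaValue 2 := by
  refine le_trans ?_ ((summable_zeta_terms le_rfl).sum_le_tsum (Finset.range n)
    fun k _ => by positivity)
  rw [genHarmonic_eq]
  refine Finset.sum_le_sum fun k _ => ?_
  have hk : (1 : ℝ) ≤ (k : ℝ) + 1 := by linarith [(Nat.cast_nonneg k : (0 : ℝ) ≤ k)]
  exact one_div_le_one_div_of_le (by positivity) (pow_le_pow_right₀ hk hs)

/-- Termwise, `1 / (k + 1/2) ≤ 1 / (k + 1) + 1 / (k + 1)^2`. -/
theorem oddHarmonic_le_add (n : ℕ) : oddHarmonic 1 n ≤ genHarmonic 1 n + genHarmonic 2 n := by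
  rw [oddHarmonic_one_eq, genHarmonic_eq, genHarmonic_eq, ← Finset.sum_add_distrib]
  refine Finset.sum_le_sum fun k _ => ?_
  have hk : (0 : ℝ) ≤ k := Nat.cast_nonneg k
  rw [pow_one, div_add_div _ _ (by positivity) (by positivity),
    div_le_div_iff₀ (by positivity) (by positivity)]
  nlinarith [mul_nonneg hk hk, mul_nonneg hk (mul_nonneg hk hk)]

theorem genHarmonic_one_le_oddHarmonic (n : ℕ) : genHarmonic 1 n ≤ oddHarmonic 1 n := by
  rw [oddHarmonic_one_eq, genHarmonic_eq]
  refine Finset.sum_le_sum fun k _ => ?_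
  rw [pow_one]
  exact one_div_le_one_div_of_le (by positivity) (by linarith)

theorem genHarmonic_mono (p : ℕ) : Monotone (genHarmonic p) :=
  monotone_nat_of_le_succ fun n => by
    rw [genHarmonic_eq, genHarmonic_eq, Finset.sum_range_succ, le_add_iff_nonneg_right]
    positivity

theorem genHarmonic_one_add_le (a b : ℕ) :
    genHarmonic 1 (a + b) ≤ genHarmonic 1 a + genHarmonic 1 b := by
  simp only [genHarmonic_eq, pow_one]
  exact sum_range_add_le (antitone_one_div_add one_pos) a b

theorem oddHarmonic_add_genHarmonic (n : ℕ) :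
    oddHarmonic 1 n + genHarmonic 1 n = 2 * genHarmonic 1 (2 * n) := by
  simp only [oddHarmonic_one_eq, genHarmonic_eq, pow_one]
  induction n with
  | zero => simp
  | succ n ih =>
    rw [Finset.sum_range_succ, Finset.sum_range_succ, show 2 * (n + 1) = 2 * n + 1 + 1 by ring,
      Finset.sum_range_succ _ (2 * n + 1), Finset.sum_range_succ _ (2 * n)]
    have e : 2 * (1 / (((2 * n : ℕ) : ℝ) + 1) + 1 / (((2 * n + 1 : ℕ) : ℝ) + 1))
        = 1 / ((n : ℝ) + 1 / 2) + 1 / ((n : ℝ) + 1) := by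
      push_cast
      field_simp
      ring
    linarith

theorem tendsto_oddHarmonic_sub_genHarmonic :
    Tendsto (fun N => oddHarmonic 1 N - genHarmonic 1 N) atTop (𝓝 (2 * Real.log 2)) := by
  have h1 := Real.tendsto_harmonic_sub_log
  have h2 := h1.comp (tendsto_id.const_mul_atTop' (by norm_num : 0 < 2) :
    Tendsto (fun n : ℕ => 2 * n) atTop atTop)
  have h := ((h2.sub h1).const_mul 2).add_const (2 * Real.log 2)
  rw [sub_self, mul_zero, zero_add] at h
  refine h.congr' ?_
  filter_upwards [eventually_gt_atTop 0] with N hN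
  have hN' : (N : ℝ) ≠ 0 := by positivity
  have := oddHarmonic_add_genHarmonic N
  simp only [Function.comp]
  rw [← genHarmonic_one_eq_harmonic, ← genHarmonic_one_eq_harmonic]
  push_cast
  rw [Real.log_mul two_ne_zero hN']
  linarith

/-- The constant coefficient is `H_{n-1} + h_N - H_{N-n}` with `n = a + 1`, where the difference
tends to `2 log 2`. -/
theorem tendsto_coeff_phiHalf (a j : ℕ) :
    Tendsto (fun N => PowerSeries.coeff j (phiHalf N (a + 1))) atTop (𝓝 (cCoeff a (j + 1))) := by
  rw [← tendsto_add_atTop_iff_nat (a + 1)]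
  simp only [add_comm _ (a + 1), coeff_phiHalf]
  rcases Nat.eq_zero_or_pos j with rfl | hj
  · have h1 := tendsto_oddHarmonic_sub_genHarmonic.add (tendsto_oddHarmonic_add_sub (a + 1))
    have h := h1.const_add (genHarmonic 1 a)
    rw [add_zero] at h
    rw [cCoeff, if_pos rfl]
    refine h.congr fun N => ?_
    rw [if_pos rfl, pow_zero, add_comm N]
    ring
  · have h := (hasSum_zetaValue (by omega : 2 ≤ j + 1)).tendsto_sum_nat.const_sub
      ((-1) ^ j * genHarmonic (j + 1) a)
    rw [cCoeff, if_neg (by omega), Nat.add_sub_cancel]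
    refine h.congr fun N => ?_
    rw [if_neg (by omega), zero_add, genHarmonic_eq _ N]

/-- A bound for the expansion coefficients at `n - 1/2` that does not depend on `N`. -/
theorem abs_coeff_phiHalf_le {N a : ℕ} (ha : a < N) (j : ℕ) :
    |PowerSeries.coeff j (phiHalf N (a + 1))|
      ≤ 2 * zetaValue 2 + 2 * genHarmonic 1 (a + 1) := by
  obtain ⟨d, rfl⟩ : ∃ d, N = a + 1 + d := ⟨N - (a + 1), by omega⟩
  rw [coeff_phiHalf]
  have hz : 0 ≤ zetaValue 2 := (genHarmonic_nonneg 2 0).trans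
    (genHarmonic_le_zetaValue_two le_rfl 0)
  have hH := genHarmonic_nonneg 1 (a + 1)
  rcases Nat.eq_zero_or_pos j with rfl | hj
  · rw [if_pos rfl, pow_zero, one_mul, zero_add]
    have h1 := oddHarmonic_le_add (a + 1 + d)
    have h2 := genHarmonic_le_zetaValue_two le_rfl (a + 1 + d)
    have h3 := genHarmonic_one_add_le (a + 1) d
    have h4 : genHarmonic 1 a ≤ genHarmonic 1 (a + 1) := genHarmonic_mono 1 (Nat.le_succ a)
    have h5 : genHarmonic 1 d ≤ genHarmonic 1 (a + 1 + d) := genHarmonic_mono 1 (by omega)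
    have h6 := genHarmonic_one_le_oddHarmonic (a + 1 + d)
    have h7 := genHarmonic_nonneg 1 a
    rw [abs_le]
    constructor <;> linarith
  · rw [if_neg (by omega), zero_add]
    have h1 := genHarmonic_le_zetaValue_two (by omega : 2 ≤ j + 1) a
    have h2 := genHarmonic_le_zetaValue_two (by omega : 2 ≤ j + 1) d
    refine (abs_sub _ _).trans ?_
    rw [abs_mul, abs_pow, abs_neg, abs_one, one_pow, one_mul,
      abs_of_nonneg (genHarmonic_nonneg _ _), abs_of_nonneg (genHarmonic_nonneg _ _)]
    linarith

theorem abs_cCoeff_le (a j : ℕ) :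
    |cCoeff a (j + 1)| ≤ 2 * zetaValue 2 + 2 * genHarmonic 1 (a + 1) :=
  le_of_tendsto (tendsto_coeff_phiHalf a j).abs
    ((eventually_gt_atTop a).mono fun _ h => abs_coeff_phiHalf_le h j)

theorem abs_prod_div_le {r : ℕ} (κ : Fin r → ℕ) (m a : ℕ) {c : Fin r → ℝ} {D : ℝ}
    (hc : ∀ j, |c j| ≤ D) :
    |(∏ j, c j ^ κ j) / (((a + 1 : ℕ) : ℝ) - 1 / 2) ^ m|
      ≤ 2 ^ m * (D ^ size κ / ((a : ℝ) + 1) ^ m) := by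
  have ha : (0 : ℝ) ≤ a := Nat.cast_nonneg a
  have hx : ((a : ℝ) + 1) / 2 ≤ ((a + 1 : ℕ) : ℝ) - 1 / 2 := by
    push_cast
    linarith
  have hx0 : 0 < ((a + 1 : ℕ) : ℝ) - 1 / 2 := lt_of_lt_of_le (by positivity) hx
  have hnum : |∏ j, c j ^ κ j| ≤ D ^ size κ := by
    rw [Finset.abs_prod, size, ← Finset.prod_pow_eq_pow_sum]
    refine Finset.prod_le_prod (fun _ _ => abs_nonneg _) fun j _ => ?_
    rw [abs_pow]
    exact pow_le_pow_left₀ (abs_nonneg _) (hc j) _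
  rw [abs_div, abs_of_pos (pow_pos hx0 m)]
  calc |∏ j, c j ^ κ j| / (((a + 1 : ℕ) : ℝ) - 1 / 2) ^ m
      ≤ D ^ size κ / (((a : ℝ) + 1) / 2) ^ m :=
        div_le_div₀ ((abs_nonneg _).trans hnum) hnum (by positivity)
          (pow_le_pow_left₀ (by positivity) hx m)
    _ = 2 ^ m * (D ^ size κ / ((a : ℝ) + 1) ^ m) := by
        rw [div_pow]
        field_simp

theorem summable_majorant (k : ℕ) {m : ℕ} (hm : 2 ≤ m) :
    Summable fun n : ℕ => 2 ^ m *
      ((2 * zetaValue 2 + 2 * genHarmonic 1 (n + 1)) ^ k / ((n : ℝ) + 1) ^ m) :=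
  (summable_genHarmonic_pow _ _ _ _ hm).mul_left _

theorem summable_cTerm {r : ℕ} (κ : Fin r → ℕ) {m : ℕ} (hm : 2 ≤ m) :
    Summable fun n : ℕ => cTerm κ m (n + 1) :=
  Summable.of_norm_bounded (summable_majorant (size κ) hm) fun n =>
    abs_prod_div_le κ m n fun j => abs_cCoeff_le n j

/-- Dominated convergence for the sum over the half-integers `n - 1/2`, `1 ≤ n ≤ N`. -/
theorem tendsto_half_integer_sum {r : ℕ} (κ : Fin r → ℕ) {m : ℕ} (hm : 2 ≤ m) :
    Tendsto (fun N => ∑ n ∈ Finset.Icc 1 N,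
        (∏ j : Fin r, PowerSeries.coeff (j : ℕ) (phiHalf N n) ^ κ j) / ((n : ℝ) - 1 / 2) ^ m) atTop
      (𝓝 (cSum κ m)) := by
  have h := tendsto_tsum_of_dominated_convergence (𝓕 := atTop)
    (f := fun N n : ℕ => if n < N then
      (∏ j : Fin r, PowerSeries.coeff (j : ℕ) (phiHalf N (n + 1)) ^ κ j)
        / (((n + 1 : ℕ) : ℝ) - 1 / 2) ^ m else 0)
    (g := fun n => cTerm κ m (n + 1)) (summable_majorant (size κ) hm) (fun n => ?_)
    (Eventually.of_forall fun N n => ?_)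
  · refine h.congr fun N => ?_
    rw [sum_Icc_one, tsum_eq_sum (s := Finset.range N)
      (fun n hn => if_neg (by simpa using hn))]
    exact Finset.sum_congr rfl fun n hn => if_pos (Finset.mem_range.1 hn)
  · have h1 := (tendsto_finsetProd Finset.univ fun j _ =>
      (tendsto_coeff_phiHalf n (j : Fin r)).pow (κ j)).div_const ((((n + 1 : ℕ) : ℝ) - 1 / 2) ^ m)
    refine h1.congr' ?_
    filter_upwards [eventually_gt_atTop n] with N hN
    rw [if_pos hN]
  · split_ifs with hn
    · exact abs_prod_div_le κ m n fun j => abs_coeff_phiHalf_le hn j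
    · rw [norm_zero]
      have hz : 0 ≤ zetaValue 2 :=
        (genHarmonic_nonneg 2 0).trans (genHarmonic_le_zetaValue_two le_rfl 0)
      have := genHarmonic_nonneg 1 (n + 1)
      positivity

/-! ### The residue at zero and the limit formula -/

/-- The contribution to the formula for `p = r + 1` of the terms of degree `k` in the expansion of
the `p`-th power at the half-integers. -/
def halfTerm (r q k : ℕ) : ℝ :=
  ∑ κ ∈ exponents r k r,
    multinom k κ * (-1) ^ (r - wsize κ) *
      ∑ l ∈ Finset.range (r - wsize κ + 1),
        ((-1) ^ l - 1) * (Nat.choose (r + 1 + q - wsize κ - l - 2) (q - 1) : ℝ)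
          * tTilde (l + 1) * cSum κ (r + 1 + q - wsize κ - l - 1)

/-- For even `l` both sides vanish, and for odd `l` the sign `(-1)^(m-l)` is `-(-1)^m`. -/
theorem neg_one_pow_sub_one_mul (m l : ℕ) (hl : l ≤ m) :
    ((-1 : ℝ) ^ l - 1) * (-1) ^ (m - l) = -((-1) ^ m * ((-1) ^ l - 1)) := by
  obtain ⟨d, rfl⟩ := Nat.exists_eq_add_of_le hl
  rw [Nat.add_sub_cancel_left, pow_add]
  rcases neg_one_pow_eq_or ℝ l with h | h <;> rw [h] <;> ring

theorem sum_half_integer_residues (r q N : ℕ) (hq : 2 ≤ q) :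
    ∑ n ∈ Finset.Icc 1 N, PowerSeries.coeff r
        (cotHalfLim * (1 + PowerSeries.X * phiHalf N n) ^ (r + 1) * invShift ((n : ℝ) - 1 / 2) ^ q)
      = -∑ k ∈ Finset.range (r + 2), (Nat.choose (r + 1) k : ℝ) *
          ∑ κ ∈ exponents r k r,
            multinom k κ * (-1) ^ (r - wsize κ) *
              ∑ l ∈ Finset.range (r - wsize κ + 1),
                ((-1) ^ l - 1) * (Nat.choose (r + 1 + q - wsize κ - l - 2) (q - 1) : ℝ)
                  * tTilde (l + 1) * ∑ n ∈ Finset.Icc 1 N,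
                    (∏ j : Fin r, PowerSeries.coeff (j : ℕ) (phiHalf N n) ^ κ j)
                      / ((n : ℝ) - 1 / 2) ^ (r + 1 + q - wsize κ - l - 1) := by
  simp only [coeff_mul_pow_mul]
  rw [Finset.sum_comm, ← Finset.sum_neg_distrib]
  refine Finset.sum_congr rfl fun k _ => ?_
  rw [← Finset.mul_sum, ← mul_neg, Finset.sum_comm, ← Finset.sum_neg_distrib]
  congr 1
  refine Finset.sum_congr rfl fun κ hκ => ?_
  have hw := (mem_exponents.1 hκ).2
  simp only [Finset.mul_sum]
  rw [Finset.sum_comm, ← Finset.sum_neg_distrib]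
  refine Finset.sum_congr rfl fun l hl => ?_
  have hl' : l ≤ r - wsize κ := Nat.lt_succ_iff.1 (Finset.mem_range.1 hl)
  rw [← Finset.sum_neg_distrib]
  refine Finset.sum_congr rfl fun n _ => ?_
  rw [coeff_invShift_pow _ (by omega), cotHalfLim, PowerSeries.coeff_mk,
    show q - 1 + (r - wsize κ - l) = r + 1 + q - wsize κ - l - 2 by omega,
    show q + (r - wsize κ - l) = r + 1 + q - wsize κ - l - 1 by omega]
  linear_combination (multinom k κ * (∏ j : Fin r, PowerSeries.coeff (j : ℕ) (phiHalf N n) ^ κ j)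
    * tTilde (l + 1) * (Nat.choose (r + 1 + q - wsize κ - l - 2) (q - 1) : ℝ)
    / ((n : ℝ) - 1 / 2) ^ (r + 1 + q - wsize κ - l - 1))
    * neg_one_pow_sub_one_mul (r - wsize κ) l hl'

theorem tendsto_half_integer_residues (r q : ℕ) (hq : 2 ≤ q) :
    Tendsto (fun N => ∑ n ∈ Finset.Icc 1 N, PowerSeries.coeff r
        (cotHalfLim * (1 + PowerSeries.X * phiHalf N n) ^ (r + 1)
          * invShift ((n : ℝ) - 1 / 2) ^ q)) atTop
      (𝓝 (-∑ k ∈ Finset.range (r + 2), (Nat.choose (r + 1) k : ℝ) * halfTerm r q k)) := by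
  simp only [sum_half_integer_residues r q _ hq]
  refine Tendsto.neg (tendsto_finsetSum _ fun k _ => Tendsto.const_mul _
    (tendsto_finsetSum _ fun κ hκ => Tendsto.const_mul _
      (tendsto_finsetSum _ fun l hl => Tendsto.const_mul _ (tendsto_half_integer_sum κ ?_))))
  have := (mem_exponents.1 hκ).2
  have := Finset.mem_range.1 hl
  omega

/-- The expansion at `0` of `∑_{n ≥ 1} (1 / (n - 1/2) + 1 / (z - (n - 1/2)))`; its constant
coefficient vanishes, in agreement with the convention `t̃(1) = 0`. -/
def phiZeroLim : PowerSeries ℝ := PowerSeries.mk fun l => -tTilde (l + 1)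

theorem tTilde_one : tTilde 1 = 0 := if_pos rfl

theorem tendsto_phiInt_zero : Tendsto (fun N => phiInt N 0) atTop (𝓝 phiZeroLim) := by
  rw [PowerSeries.WithPiTopology.tendsto_iff_coeff_tendsto]
  intro l
  rcases Nat.eq_zero_or_pos l with rfl | hl
  · have h := tendsto_phiVal_natCast 0
    rw [phiZeroLim, PowerSeries.coeff_mk, zero_add, tTilde_one, neg_zero, ← oddHarmonic_zero]
    refine h.congr fun N => ?_
    rw [phiVal, Nat.cast_zero, PowerSeries.coeff_zero_eq_constantCoeff_apply]
  · have h := (hasSum_tTilde (by omega : 2 ≤ l + 1)).tendsto_sum_nat.neg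
    rw [phiZeroLim, PowerSeries.coeff_mk]
    refine h.congr fun N => ?_
    rw [phiInt, map_sum, sum_Icc_one, ← Finset.sum_neg_distrib]
    refine Finset.sum_congr rfl fun n _ => ?_
    rw [map_add, PowerSeries.coeff_C, if_neg (by omega), zero_add, invShift, PowerSeries.coeff_mk]
    push_cast
    have hn : ((n : ℝ) + 1 - 1 / 2) ^ (l + 1) ≠ 0 := by
      have : (0 : ℝ) < (n : ℝ) + 1 - 1 / 2 := by linarith [(Nat.cast_nonneg n : (0 : ℝ) ≤ n)]
      positivity
    rw [zero_sub, neg_pow ((n : ℝ) + 1 - 1 / 2)]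
    generalize ((n : ℝ) + 1 - 1 / 2) ^ (l + 1) = x at hn
    rcases neg_one_pow_eq_or ℝ l with h | h <;>
    · rw [pow_succ (-1 : ℝ) l, h]
      field_simp
      try norm_num

/-- As `φ` vanishes at `0`, only tuples of positive integers contribute. -/
theorem coeff_phiZeroLim_pow (p q : ℕ) :
    PowerSeries.coeff q (phiZeroLim ^ p)
      = (-1) ^ p * ∑ k ∈ compositions p q, ∏ j, tTilde (k j + 1) := by
  classical
  have h : phiZeroLim ^ p = ∏ _j : Fin p, phiZeroLim := by simp
  rw [h, PowerSeries.coeff_prod, Finset.mul_sum]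
  symm
  refine Finset.sum_of_injOn (fun k => Finsupp.equivFunOnFinite.symm k)
    (Finsupp.equivFunOnFinite.symm.injective.injOn) (fun k hk => ?_) (fun k hk hk' => ?_)
    (fun k _ => ?_)
  · rw [Finset.mem_coe, Finset.mem_finsuppAntidiag]
    exact ⟨(mem_compositions.1 hk).2, Finset.subset_univ _⟩
  · obtain ⟨j, hj⟩ : ∃ j, k j = 0 := by
      by_contra! hne
      refine hk' ⟨k, ?_, by ext; simp⟩
      rw [Finset.mem_coe, mem_compositions]
      exact ⟨fun j => Nat.one_le_iff_ne_zero.2 (hne j), (Finset.mem_finsuppAntidiag.1 hk).1⟩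
    refine Finset.prod_eq_zero (Finset.mem_univ j) ?_
    rw [hj, phiZeroLim, PowerSeries.coeff_mk, zero_add, tTilde_one, neg_zero]
  · simp [phiZeroLim, Finset.prod_neg]

/-- The weighted compositions are sorted by the even number `i = 2 k_1`. -/
theorem sum_weightedCompositions (p q : ℕ) (f : ℕ → (Fin p → ℕ) → ℝ) :
    ∑ k ∈ weightedCompositions p q, f (2 * k 0) (fun j => k j.succ)
      = ∑ i ∈ Finset.range (q + 1), ∑ k ∈ compositions p (q - i),
          if Even i ∧ i ≠ 0 then f i k else 0 := by
  rw [Finset.sum_sigma']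
  refine Finset.sum_of_injOn (fun k => ⟨2 * k 0, fun j => k j.succ⟩) (fun k _ k' _ h => ?_)
    (fun k hk => ?_) (fun k hk hk' => ?_) (fun k hk => ?_)
  · obtain ⟨h0, hs⟩ := Sigma.mk.inj_iff.1 h
    funext j
    refine Fin.cases ?_ (fun j => congrFun (eq_of_heq hs) j) j
    omega
  · obtain ⟨h1, h2⟩ := mem_weightedCompositions.1 hk
    rw [Finset.mem_coe, Finset.mem_sigma, Finset.mem_range, mem_compositions]
    refine ⟨?_, fun j => h1 j.succ, ?_⟩
    · dsimp only
      omega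
    · dsimp only
      omega
  · obtain ⟨i, k⟩ := k
    obtain ⟨hi, hk⟩ := Finset.mem_sigma.1 hk
    have hi := Finset.mem_range.1 hi
    obtain ⟨hk1, hk2⟩ := mem_compositions.1 hk
    dsimp only at hi hk1 hk2 ⊢
    refine if_neg fun ⟨⟨s, hs⟩, h0⟩ => hk' ⟨Fin.cons s k, ?_, ?_⟩
    · rw [Finset.mem_coe, mem_weightedCompositions]
      refine ⟨fun j => ?_, ?_⟩
      · induction j using Fin.cases with
        | zero =>
          change 1 ≤ s
          omega
        | succ j => exact hk1 j
      · change 2 * s + ∑ j, k j = q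
        omega
    · simp only [Fin.cons_zero, Fin.cons_succ]
      rw [hs, two_mul]
  · have := (mem_weightedCompositions.1 hk).1 0
    exact (if_pos (show Even (2 * k 0) ∧ 2 * k 0 ≠ 0 from ⟨even_two_mul _, by omega⟩)).symm

theorem residue_zero (p q : ℕ) :
    PowerSeries.coeff q ((1 + PowerSeries.X * cotZeroLim) * phiZeroLim ^ p)
      = (-1) ^ p * ∑ k ∈ compositions p q, ∏ j, tTilde (k j + 1)
        - 2 * (-1) ^ p * ∑ k ∈ weightedCompositions p q,
            zetaValue (2 * k 0) * ∏ j : Fin p, tTilde (k j.succ + 1) := by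
  rw [add_mul, one_mul, map_add, coeff_phiZeroLim_pow, sub_eq_add_neg]
  congr 1
  rw [sum_weightedCompositions p q fun i k => zetaValue i * ∏ j : Fin p, tTilde (k j + 1),
    PowerSeries.coeff_mul, Finset.Nat.sum_antidiagonal_eq_sum_range_succ
      (fun i j => PowerSeries.coeff i (PowerSeries.X * cotZeroLim)
        * PowerSeries.coeff j (phiZeroLim ^ p)), Finset.mul_sum, ← Finset.sum_neg_distrib]
  refine Finset.sum_congr rfl fun i _ => ?_
  rw [coeff_phiZeroLim_pow]
  cases i with
  | zero => simp
  | succ i =>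
    rw [PowerSeries.coeff_succ_X_mul, cotZeroLim, PowerSeries.coeff_mk]
    by_cases h : Odd i
    · rw [if_pos h]
      simp only [h.add_one, ne_eq, Nat.succ_ne_zero, not_false_eq_true, and_self, if_true,
        ← Finset.mul_sum]
      ring
    · have h' : ¬ Even (i + 1) := by
        rw [Nat.even_add_one, not_not]
        exact Nat.not_odd_iff_even.1 h
      simp [h, h']

/-- The limit `N → ∞` of `residue_identity_cot`. -/
theorem typeTSum_add_residues (r q : ℕ) (hq : 2 ≤ q) :
    (1 + (-1) ^ q) * typeTSum (fun _ : Fin (r + 1) => 1) q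
      + ((-1) ^ (r + 1) * ∑ k ∈ compositions (r + 1) q, ∏ j, tTilde (k j + 1)
        - 2 * (-1) ^ (r + 1) * ∑ k ∈ weightedCompositions (r + 1) q,
            zetaValue (2 * k 0) * ∏ j : Fin (r + 1), tTilde (k j.succ + 1))
      + -∑ k ∈ Finset.range (r + 2), (Nat.choose (r + 1) k : ℝ) * halfTerm r q k = 0 := by
  rw [← residue_zero]
  have h0 : Tendsto (fun N => PowerSeries.coeff q
      ((1 + PowerSeries.X * cotZeroLim) * phiInt N 0 ^ (r + 1))) atTop
      (𝓝 (PowerSeries.coeff q ((1 + PowerSeries.X * cotZeroLim) * phiZeroLim ^ (r + 1)))) :=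
    ((PowerSeries.WithPiTopology.continuous_coeff ℝ q).tendsto _).comp
      ((tendsto_phiInt_zero.pow _).const_mul _)
  exact tendsto_nhds_unique (((tendsto_integer_residues (r + 1) q hq).add h0).add
    (tendsto_half_integer_residues r q hq))
    (tendsto_const_nhds.congr fun N => (residue_identity_cot (r + 1) q N (by omega) hq).symm)

theorem cSum_zero (r : ℕ) {m : ℕ} (hm : 2 ≤ m) : cSum (0 : Fin r → ℕ) m = tTilde m := by
  rw [tTilde, if_neg (by omega), cSum]
  refine tsum_congr fun n => ?_
  simp [cTerm]

theorem exponents_zero (r : ℕ) : exponents r 0 r = {0} := by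
  ext κ
  rw [mem_exponents, Finset.mem_singleton]
  constructor
  · rintro ⟨h, -⟩
    funext j
    exact Finset.sum_eq_zero_iff.1 h j (Finset.mem_univ j)
  · rintro rfl
    simp [size, wsize]

theorem halfTerm_zero (r q : ℕ) (hq : 2 ≤ q) :
    halfTerm r q 0 = (-1) ^ r * ∑ l ∈ Finset.range (r + 1),
      ((-1) ^ l - 1) * (Nat.choose (r + 1 + q - l - 2) (q - 1) : ℝ)
        * tTilde (l + 1) * tTilde (r + 1 + q - l - 1) := by
  have hw : wsize (0 : Fin r → ℕ) = 0 := by simp [wsize]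
  have hm : multinom 0 (0 : Fin r → ℕ) = 1 := by simp [multinom]
  rw [halfTerm, exponents_zero, Finset.sum_singleton, hw, hm, one_mul, Nat.sub_zero, Nat.sub_zero]
  congr 1
  refine Finset.sum_congr rfl fun l hl => ?_
  have := Finset.mem_range.1 hl
  rw [cSum_zero r (by omega)]

/-- The general formula for `p = r + 1`; the terms with `k = 0` at the half-integers are
separated. -/
theorem typeTSum_eq (r q : ℕ) (hq : 2 ≤ q) :
    (1 + (-1) ^ q) * typeTSum (fun _ : Fin (r + 1) => 1) q
      = (-1) ^ r * ∑ l ∈ Finset.range (r + 1),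
          ((-1) ^ l - 1) * (Nat.choose (r + 1 + q - l - 2) (q - 1) : ℝ)
            * tTilde (l + 1) * tTilde (r + 1 + q - l - 1)
        + ∑ k ∈ Finset.Icc 1 (r + 1), (Nat.choose (r + 1) k : ℝ) * halfTerm r q k
        + (-1) ^ (r + 1 + 1) * ∑ k ∈ compositions (r + 1) q, ∏ j, tTilde (k j + 1)
        - 2 * (-1) ^ (r + 1 + 1) * ∑ k ∈ weightedCompositions (r + 1) q,
            zetaValue (2 * k 0) * ∏ j : Fin (r + 1), tTilde (k j.succ + 1) := by
  have h := typeTSum_add_residues r q hq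
  rw [Finset.sum_range_succ', Nat.choose_zero_right, Nat.cast_one, one_mul,
    halfTerm_zero r q hq] at h
  rw [sum_Icc_one, pow_succ (-1 : ℝ) (r + 1)]
  linarith

theorem size_le_wsize {r : ℕ} (κ : Fin r → ℕ) : size κ ≤ wsize κ :=
  Finset.sum_le_sum fun j _ => Nat.le_mul_of_pos_left _ (Nat.succ_pos j)

/-- For `k ≥ r` every exponent has `|κ̃| ≥ r`, which leaves only `l = 0`, where `(-1)^l - 1 = 0`. -/
theorem halfTerm_eq_zero (r q k : ℕ) (hk : r ≤ k) : halfTerm r q k = 0 := by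
  refine Finset.sum_eq_zero fun κ hκ => ?_
  obtain ⟨h1, h2⟩ := mem_exponents.1 hκ
  have := size_le_wsize κ
  rw [show r - wsize κ = 0 by omega, zero_add, Finset.sum_range_one]
  simp

/-- The odd part of `∑ 1 / n^2 = π^2 / 6`. -/
theorem tTilde_two : tTilde 2 = Real.pi ^ 2 / 2 := by
  have h := hasSum_zeta_two
  have he : HasSum (fun k : ℕ => 1 / (((2 * k : ℕ) : ℝ)) ^ 2) (1 / 4 * (Real.pi ^ 2 / 6)) := by
    have e : (fun k : ℕ => 1 / (((2 * k : ℕ) : ℝ)) ^ 2)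
        = fun k : ℕ => 1 / 4 * (1 / (k : ℝ) ^ 2) := by
      funext k
      push_cast
      ring
    rw [e]
    exact h.mul_left (1 / 4)
  have ho : HasSum (fun k : ℕ => 1 / (((2 * k + 1 : ℕ) : ℝ)) ^ 2) (1 / 4 * tTilde 2) := by
    have e : (fun k : ℕ => 1 / (((2 * k + 1 : ℕ) : ℝ)) ^ 2)
        = fun k : ℕ => 1 / 4 * (1 / ((k : ℝ) + 1 - 1 / 2) ^ 2) := by
      funext k
      push_cast
      rw [show (k : ℝ) + 1 - 1 / 2 = (2 * k + 1) / 2 by ring]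
      field_simp
      norm_num
    rw [e]
    exact (hasSum_tTilde le_rfl).mul_left (1 / 4)
  have := (HasSum.even_add_odd (f := fun n : ℕ => 1 / (n : ℝ) ^ 2) he ho).unique h
  linarith

theorem summable_harmonicTerm {q : ℕ} (hq : 2 ≤ q) :
    Summable fun n : ℕ => harmonicTerm q (n + 1) := by
  refine ((summable_cTerm ![1] hq).sub ((hasSum_tTilde hq).summable.mul_left
    (2 * Real.log 2))).congr fun n => ?_
  simp [cTerm, cCoeff, harmonicTerm]
  ring

theorem cSum_one_zero {q : ℕ} (hq : 2 ≤ q) :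
    cSum ![1, 0] q = ∑' n : ℕ, harmonicTerm q (n + 1) + 2 * Real.log 2 * tTilde q := by
  have h := (summable_harmonicTerm hq).hasSum.add ((hasSum_tTilde hq).mul_left (2 * Real.log 2))
  rw [← h.tsum_eq, cSum]
  refine tsum_congr fun n => ?_
  simp [cTerm, cCoeff, harmonicTerm, Fin.prod_univ_two]
  ring

theorem exponents_two_one : exponents 2 1 2 = {![1, 0], ![0, 1]} := by decide

theorem halfTerm_two_one {q : ℕ} (hq : 2 ≤ q) :
    halfTerm 2 q 1
      = 2 * tTilde 2 * (∑' n : ℕ, harmonicTerm q (n + 1) + 2 * Real.log 2 * tTilde q) := by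
  rw [halfTerm, exponents_two_one, Finset.sum_pair (by decide)]
  have h1 : wsize ![1, 0] = 1 := by decide
  have h2 : wsize ![0, 1] = 2 := by decide
  have h3 : multinom 1 ![1, 0] = 1 := by simp [multinom]
  rw [h1, h2, h3, ← cSum_one_zero hq]
  rw [Finset.sum_range_succ, Finset.sum_range_one, Nat.sub_self, zero_add, Finset.sum_range_one,
    show 2 + 1 + q - 1 - 1 - 2 = q - 1 by omega, show 2 + 1 + q - 1 - 1 - 1 = q by omega,
    Nat.choose_self]
  norm_num

end EulerTypeSum

end

open EulerTypeSum in
theorem theorem4p1 :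
    -- the general formula, with the convergence of all series in it
    (∀ p q : ℕ, 1 ≤ p → 1 < q →
      Summable (fun n : ℕ => typeTTerm (fun _ : Fin p => 1) q (n + 1)) ∧
      (∀ (κ : Fin (p - 1) → ℕ) (l : ℕ), wsize κ + l ≤ p - 1 →
        Summable (fun n : ℕ => cTerm κ (p + q - wsize κ - l - 1) (n + 1))) ∧
      (1 + (-1) ^ q) * typeTSum (fun _ : Fin p => 1) q =
        (-1) ^ (p - 1) * ∑ l ∈ Finset.range p,
            ((-1) ^ l - 1) * (Nat.choose (p + q - l - 2) (q - 1) : ℝ)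
              * tTilde (l + 1) * tTilde (p + q - l - 1)
        + ∑ k ∈ Finset.Icc 1 p, (Nat.choose p k : ℝ) *
            ∑ κ ∈ exponents (p - 1) k (p - 1),
              multinom k κ * (-1) ^ (p - 1 - wsize κ) *
                ∑ l ∈ Finset.range (p - 1 - wsize κ + 1),
                  ((-1) ^ l - 1) * (Nat.choose (p + q - wsize κ - l - 2) (q - 1) : ℝ)
                    * tTilde (l + 1) * cSum κ (p + q - wsize κ - l - 1)
        + (-1) ^ (p + 1) * ∑ k ∈ compositions p q, ∏ j, tTilde (k j + 1)
        - 2 * (-1) ^ (p + 1) * ∑ k ∈ weightedCompositions p q,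
            zetaValue (2 * k 0) * ∏ j : Fin p, tTilde (k j.succ + 1)) ∧
    -- the case `p = 2`
    (∀ q : ℕ, 1 < q →
      (1 + (-1) ^ q) * typeTSum (fun _ : Fin 2 => 1) q =
        Real.pi ^ 2 * tTilde q
        - ∑ k ∈ compositions 2 q, tTilde (k 0 + 1) * tTilde (k 1 + 1)
        + 2 * ∑ k ∈ weightedCompositions 2 q,
            zetaValue (2 * k 0) * tTilde (k 1 + 1) * tTilde (k 2 + 1)) ∧
    -- the case `p = 3`
    (∀ q : ℕ, 1 < q →
      Summable (fun n : ℕ => harmonicTerm q (n + 1)) ∧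
      (1 + (-1) ^ q) * typeTSum (fun _ : Fin 3 => 1) q =
        -2 * q * tTilde 2 * tTilde (q + 1)
        + 6 * tTilde 2 * ∑' n : ℕ, harmonicTerm q (n + 1)
        + 12 * Real.log 2 * tTilde 2 * tTilde q
        + ∑ k ∈ compositions 3 q,
            tTilde (k 0 + 1) * tTilde (k 1 + 1) * tTilde (k 2 + 1)
        - 2 * ∑ k ∈ weightedCompositions 3 q,
            zetaValue (2 * k 0) * tTilde (k 1 + 1) * tTilde (k 2 + 1) * tTilde (k 3 + 1)) := by

  refine ⟨fun p q hp hq => ?_, fun q hq => ?_, fun q hq => ⟨summable_harmonicTerm hq, ?_⟩⟩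
  · obtain ⟨r, rfl⟩ : ∃ r, p = r + 1 := ⟨p - 1, by omega⟩
    exact ⟨summable_typeTTerm _ _ hq, fun κ l h => summable_cTerm κ (by omega), typeTSum_eq r q hq⟩
  · have h := typeTSum_eq 1 q hq
    have e : ∑ k ∈ Finset.Icc 1 (1 + 1), (Nat.choose (1 + 1) k : ℝ) * halfTerm 1 q k = 0 :=
      Finset.sum_eq_zero fun k hk => by
        rw [halfTerm_eq_zero 1 q k (Finset.mem_Icc.1 hk).1, mul_zero]
    rw [e, Finset.sum_range_succ, Finset.sum_range_one,
      show 1 + 1 + q - 1 - 2 = q - 1 by omega, show 1 + 1 + q - 1 - 1 = q by omega,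
      Nat.choose_self] at h
    have c₁ : ∑ k ∈ compositions (1 + 1) q, ∏ j, tTilde (k j + 1)
        = ∑ k ∈ compositions 2 q, tTilde (k 0 + 1) * tTilde (k 1 + 1) :=
      Finset.sum_congr rfl fun k _ => Fin.prod_univ_two _
    have c₂ : ∑ k ∈ weightedCompositions (1 + 1) q,
          zetaValue (2 * k 0) * ∏ j : Fin (1 + 1), tTilde (k j.succ + 1)
        = ∑ k ∈ weightedCompositions 2 q,
          zetaValue (2 * k 0) * tTilde (k 1 + 1) * tTilde (k 2 + 1) :=
      Finset.sum_congr rfl fun k _ => by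
        rw [Fin.prod_univ_two, ← mul_assoc]
        rfl
    rw [c₁, c₂] at h
    refine h.trans ?_
    rw [one_add_one_eq_two, tTilde_two]
    ring
  · have h := typeTSum_eq 2 q hq
    have e : ∑ k ∈ Finset.Icc 1 (2 + 1), (Nat.choose (2 + 1) k : ℝ) * halfTerm 2 q k
        = 3 * halfTerm 2 q 1 := by
      rw [sum_Icc_one, Finset.sum_range_succ, Finset.sum_range_succ, Finset.sum_range_one,
        halfTerm_eq_zero 2 q 2 le_rfl, halfTerm_eq_zero 2 q 3 (by omega)]
      norm_num
    rw [e, halfTerm_two_one hq, Finset.sum_range_succ, Finset.sum_range_succ, Finset.sum_range_one,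
      show 2 + 1 + q - 1 - 2 = q by omega, show 2 + 1 + q - 1 - 1 = q + 1 by omega,
      Nat.choose_symm_of_eq_add (show q = (q - 1) + 1 by omega), Nat.choose_one_right] at h
    have c₁ : ∑ k ∈ compositions (2 + 1) q, ∏ j, tTilde (k j + 1)
        = ∑ k ∈ compositions 3 q, tTilde (k 0 + 1) * tTilde (k 1 + 1) * tTilde (k 2 + 1) :=
      Finset.sum_congr rfl fun k _ => Fin.prod_univ_three _
    have c₂ : ∑ k ∈ weightedCompositions (2 + 1) q,
          zetaValue (2 * k 0) * ∏ j : Fin (2 + 1), tTilde (k j.succ + 1)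
        = ∑ k ∈ weightedCompositions 3 q,
          zetaValue (2 * k 0) * tTilde (k 1 + 1) * tTilde (k 2 + 1) * tTilde (k 3 + 1) :=
      Finset.sum_congr rfl fun k _ => by
        rw [Fin.prod_univ_three, ← mul_assoc, ← mul_assoc]
        rfl
    rw [c₁, c₂] at h
    refine h.trans ?_
    rw [one_add_one_eq_two]
    ring
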